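/- Let $p\in[2,\infty)$. There is a constant $C<\infty$ depending only on $p$ such that the following holds. Let $(\Omega,\mathcal F,\mathbf P)$ be a probability space and $(\mathbb U,\mathcal U,\mu)$ a $\sigma$-finite measure space. Let $\mathbf N_\sigma$ be the set of $\sigma$-finite measures on $\mathbb U$ with values in $\{0,1,2,\dots,\infty\}$, equipped with the smallest $\sigma$-algebra $\mathcal N_\sigma$ making $\xi\mapsto\xi(W)$ measurable for every $W\in\mathcal U$. Let $\eta:\Omega\to\mathbf N_\sigma$ be a Poisson point process on $\mathbb U$ with intensity measure $\mu$. Let $F=f(\eta)$, where $f:\mathbf N_\sigma\to\mathbb R$ is $\mathcal N_\sigma$-measurable, be such that $\mathbb E|F|<\infty$, and put $$D_uF:=f(\eta+\delta_u)-f(\eta),\qquad u\in\mathbb U .$$ Then, as an inequality in $[0,\infty]$, $$\|F\|_{L^p_\omega}\le C\left(|\mathbb E F|+\|D_uF\|_{L^p_\omega L^2_u\cap L^p_\omega L^p_u}\right),$$ where $$\|G\|_{L^p_\omega L^2_u\cap L^p_\omega L^p_u}:=\max\left\{\left(\mathbb E\Big(\int_{\mathbb U}|G_u|^2\,d\mu(u)\Big)^{p/2}\right)^{1/p},\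 \left(\mathbb E\int_{\mathbb U}|G_u|^p\,d\mu(u)\right)^{1/p}\right\}.$$ Moreover, with the same constant $C$, $$\|F\|_{L^p_\omega}\le C\left(|\mathbb E F|+\|D_uF\|_{\Sigma_u^{\{2,p\}}L^p_\omega}\right),\qquad \|G\|_{\Sigma_u^{\{2,p\}}L^p_\omega}:=\sum_{q\in\{2,p\}}\left(\int_{\mathbb U}\big(\mathbb E|G_u|^p\big)^{q/p}\,d\mu(u)\right)^{1/q},$$ where the sum runs over the set $\{2,p\}$ (so it has a single term if $p=2$). -/

import Mathlib

open MeasureTheory ProbabilityTheory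
open scoped ENNReal NNReal

/-- `ξ` is a `σ`-finite measure taking values in `{0, 1, 2, …, ∞}`. -/
def IsCountingMeasure {U : Type*} [MeasurableSpace U] (ξ : Measure U) : Prop :=
  SigmaFinite ξ ∧ ∀ W : Set U, MeasurableSet W → ξ W = ∞ ∨ ∃ n : ℕ, ξ W = n

/-- The space `𝐍_σ` of `σ`-finite measures on `U` with values in `{0, 1, 2, …, ∞}`. -/
abbrev CountingMeasure (U : Type*) [MeasurableSpace U] : Type _ :=
  {ξ : Measure U // IsCountingMeasure ξ}

/-- The `σ`-algebra on `𝐍_σ` (restricted from Mathlib's `σ`-algebra on `Measure U`) is the smallest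
one that makes every evaluation `ξ ↦ ξ W`, with `W` measurable, measurable. -/
theorem CountingMeasure.measurableSpace_eq (U : Type*) [MeasurableSpace U] :
    (inferInstance : MeasurableSpace (CountingMeasure U)) =
      ⨆ (W : Set U) (_ : MeasurableSet W),
        (borel ℝ≥0∞).comap (fun ξ : CountingMeasure U => (ξ : Measure U) W) := by
  have h : (inferInstance : MeasurableSpace (CountingMeasure U)) =
      (⨆ (W : Set U) (_ : MeasurableSet W),
        (borel ℝ≥0∞).comap (fun ξ : Measure U => ξ W)).comap Subtype.val := rfl
  rw [h]
  simp only [MeasurableSpace.comap_iSup, MeasurableSpace.comap_comp]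
  rfl

/-- The configuration `ξ + δ_u`. -/
noncomputable def CountingMeasure.addPoint {U : Type*} [MeasurableSpace U]
    (ξ : CountingMeasure U) (u : U) : CountingMeasure U :=
  ⟨(ξ : Measure U) + Measure.dirac u, by
    obtain ⟨ξ, hσ, hξ⟩ := ξ
    refine ⟨inferInstanceAs (SigmaFinite (ξ + Measure.dirac u)), fun W hW => ?_⟩
    rw [Measure.add_apply, Measure.dirac_apply' u hW]
    rcases hξ W hW with h | ⟨n, h⟩
    · exact Or.inl (by simp [h])
    · right
      by_cases hu : u ∈ W
      · exact ⟨n + 1, by simp [h, hu]⟩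
      · exact ⟨n, by simp [h, hu]⟩⟩

/-- The difference operator `D_u f (ξ) = f (ξ + δ_u) - f ξ`. -/
noncomputable def diffOp {U : Type*} [MeasurableSpace U] (u : U)
    (f : CountingMeasure U → ℝ) (ξ : CountingMeasure U) : ℝ :=
  f (ξ.addPoint u) - f ξ

/-- The Poisson distribution with parameter `r ∈ [0, ∞]`, as a law on `[0, ∞]`; for `r = ∞` it is
the point mass at `∞`. -/
noncomputable def extPoissonMeasure (r : ℝ≥0∞) : Measure ℝ≥0∞ :=
  if r = ∞ then Measure.dirac ∞ else (poissonMeasure r.toNNReal).map (fun n : ℕ => (n : ℝ≥0∞))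

/-- `η` is a Poisson point process on `U` with intensity measure `μ`, defined on the probability
space `(Ω, P)`: a random element of `𝐍_σ` such that `η W` is Poisson distributed with parameter
`μ W` for each measurable `W`, and `η W₁, …, η Wₘ` are independent for disjoint measurable
`W₁, …, Wₘ`. -/
structure IsPoissonProcess {Ω U : Type*} [MeasurableSpace Ω] [MeasurableSpace U]
    (η : Ω → CountingMeasure U) (μ : Measure U) (P : Measure Ω) : Prop where
  measurable : Measurable η
  law : ∀ W : Set U, MeasurableSet W →
    P.map (fun ω => (η ω : Measure U) W) = extPoissonMeasure (μ W)
  indep : ∀ (m : ℕ) (W : Fin m → Set U), (∀ i, MeasurableSet (W i)) →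
    Pairwise (fun i j => Disjoint (W i) (W j)) →
    iIndepFun (fun (i : Fin m) (ω : Ω) => (η ω : Measure U) (W i)) P

/-- The norm `‖G‖_{L^p_ω L^q_u}` of `G : Ω → U → ℝ`: first the `L^q` norm in `u`, then the `L^p` norm
in `ω`. -/
noncomputable def mixedNorm {Ω U : Type*} [MeasurableSpace Ω] [MeasurableSpace U]
    (p q : ℝ) (P : Measure Ω) (μ : Measure U) (G : Ω → U → ℝ) : ℝ≥0∞ :=
  eLpNorm (fun ω => eLpNorm (G ω) (ENNReal.ofReal q) μ) (ENNReal.ofReal p) P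

/-- The norm of the intersection `L^p_ω L^2_u ∩ L^p_ω L^p_u`. -/
noncomputable def interNorm {Ω U : Type*} [MeasurableSpace Ω] [MeasurableSpace U]
    (p : ℝ) (P : Measure Ω) (μ : Measure U) (G : Ω → U → ℝ) : ℝ≥0∞ :=
  max (mixedNorm p 2 P μ G) (mixedNorm p p P μ G)

/-- The norm `‖G‖_{Σ_u^S L^p_ω} = ∑_{q ∈ S} ‖G‖_{L^q_u L^p_ω}` for a finite set `S` of exponents. -/
noncomputable def sigmaNorm {Ω U : Type*} [MeasurableSpace Ω] [MeasurableSpace U]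
    (S : Finset ℝ) (p : ℝ) (P : Measure Ω) (μ : Measure U) (G : Ω → U → ℝ) : ℝ≥0∞ :=
  ∑ q ∈ S, mixedNorm q p μ P (fun u ω => G ω u)

/-! ### The Poincaré inequality for the Poisson distribution -/

/-! Everything rests on the `L^2` Poincaré inequality `Var f ≤ E ∫ |D_u f|^2 dμ`
(`IsPoissonProcess.poincare`), which is then applied to `|f| ^ (p / 2)`.

For one Poisson variable, twice the variance is the mean of `(g n - g m) ^ 2` over independent `m,
n`. Telescoping and Cauchy–Schwarz bound it by squared increments, whose weights sum exactly to `r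
π_j` by `poissonMeasure_kernel`. Tensorization gives finite products, hence functions of the counts
in disjoint sets. Atoms reduce overlapping sets to disjoint ones, and density of cylinder functions
reaches functionals of the configuration in a set of finite measure. For σ-finite `μ`, the
configuration is glued from independent copies inside and outside a large set `S`: the finite case
applies inside `S`, and the dependence on the outside is small in `L^2`.

For `p ≥ 2` and bounded `f`, this yields `E|f|^p ≤ 2 (E|f|^(p/2))^2 + 2 E ∫ |D_u |f|^(p/2)|^2`. The
chain rule and Hölder (`sq_abs_rpow_sub_le`, `IsControl`) bound the last term by lower powers of
`‖f‖_p` times powers of the norm of `Df`. The first term is cut at a level `K` comparable to `|E f|`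
plus that norm; Markov's inequality makes the part above `K` a small multiple of `E|f|^p`, which is
absorbed (`sq_lintegral_rpow_le`, `le_mul_of_forall_rpow_le`). Truncation and Fatou remove
boundedness. Both norms of the theorem are instances of `IsControl`, hence the common constant. -/

theorem natCast_succ_mul_poissonMeasure_singleton (r : ℝ≥0) (n : ℕ) :
    ((n + 1 : ℕ) : ℝ≥0∞) * poissonMeasure r {n + 1} = r * poissonMeasure r {n} := by
  rw [poissonMeasure_singleton, poissonMeasure_singleton, ← ENNReal.ofReal_natCast,
    ← ENNReal.ofReal_coe_nnreal, ← ENNReal.ofReal_mul (by positivity),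
    ← ENNReal.ofReal_mul (by positivity)]
  congr 1
  rw [Nat.factorial_succ]
  push_cast
  field_simp
  ring

theorem tsum_poissonMeasure_singleton (r : ℝ≥0) : ∑' n, poissonMeasure r {n} = 1 := by
  have h := lintegral_countable' (μ := poissonMeasure r) (fun _ : ℕ => (1 : ℝ≥0∞))
  simpa using h.symm

theorem sum_range_natCast_mul_poissonMeasure (r : ℝ≥0) (j : ℕ) :
    ∑ m ∈ Finset.range (j + 1), (m : ℝ≥0∞) * poissonMeasure r {m} + r * poissonMeasure r {j} =
      r * ∑ m ∈ Finset.range (j + 1), poissonMeasure r {m} := by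
  induction j with
  | zero => simp
  | succ j ih =>
    rw [Finset.sum_range_succ, natCast_succ_mul_poissonMeasure_singleton, ih,
      Finset.sum_range_succ _ (j + 1), mul_add]

theorem tsum_natCast_mul_poissonMeasure_tail (r : ℝ≥0) (j : ℕ) :
    ∑' k : ℕ, ((k + (j + 1) : ℕ) : ℝ≥0∞) * poissonMeasure r {k + (j + 1)} =
      r * ∑' k : ℕ, poissonMeasure r {k + (j + 1)} + r * poissonMeasure r {j} := by
  have h : ∀ k : ℕ, ((k + (j + 1) : ℕ) : ℝ≥0∞) * poissonMeasure r {k + (j + 1)} =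
      r * poissonMeasure r {k + j} := fun k =>
    natCast_succ_mul_poissonMeasure_singleton r (k + j)
  simp_rw [h]
  rw [ENNReal.tsum_mul_left, tsum_eq_zero_add' ENNReal.summable, mul_add, add_comm, zero_add]
  congr 3
  ext k
  rw [add_right_comm, add_assoc]

/-- The kernel identity `∑_{m ≤ j < n} π_m π_n (n - m) = r π_j` for the Poisson weights `π`. -/
theorem poissonMeasure_kernel (r : ℝ≥0) (j : ℕ) :
    ∑ m ∈ Finset.range (j + 1), ∑' k : ℕ, poissonMeasure r {m} * poissonMeasure r {k + (j + 1)} *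
      ((k + (j + 1) - m : ℕ) : ℝ≥0∞) = r * poissonMeasure r {j} := by
  set a : ℕ → ℝ≥0∞ := fun n => poissonMeasure r {n} with ha
  set T := ∑' k : ℕ, a (k + (j + 1)) with hT
  set S := ∑ m ∈ Finset.range (j + 1), a m with hS
  set A := ∑ m ∈ Finset.range (j + 1), (m : ℝ≥0∞) * a m with hA
  have hST : S + T = 1 := by
    rw [← tsum_poissonMeasure_singleton r]
    exact ENNReal.summable.sum_add_tsum_nat_add' (f := a)
  have hA' : A + r * a j = r * S := sum_range_natCast_mul_poissonMeasure r j
  have hB := tsum_natCast_mul_poissonMeasure_tail r j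
  change (∑' k : ℕ, ((k + (j + 1) : ℕ) : ℝ≥0∞) * a (k + (j + 1))) = r * T + r * a j at hB
  -- The double sum is `S * (r T + r a_j) - A * T`. Subtraction in `ℝ≥0∞` is avoided by adding the
  -- finite quantity `A * T` to both sides.
  have hfin : A * T ≠ ∞ := by
    refine ENNReal.mul_ne_top ?_ ?_
    · refine (ENNReal.sum_lt_top.2 fun m _ => ?_).ne
      exact ENNReal.mul_lt_top (by simp) (measure_lt_top _ _)
    · exact ((le_add_self.trans hST.le).trans_lt ENNReal.one_lt_top).ne
  refine (ENNReal.add_left_inj hfin).1 ?_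
  calc ∑ m ∈ Finset.range (j + 1), ∑' k : ℕ, a m * a (k + (j + 1)) *
        ((k + (j + 1) - m : ℕ) : ℝ≥0∞) + A * T
      = ∑ m ∈ Finset.range (j + 1), ∑' k : ℕ, a m * (((k + (j + 1) : ℕ) : ℝ≥0∞) *
          a (k + (j + 1))) := by
        rw [hA, Finset.sum_mul, ← Finset.sum_add_distrib]
        refine Finset.sum_congr rfl fun m hm => ?_
        rw [hT, ← ENNReal.tsum_mul_left, ← ENNReal.tsum_add]
        refine tsum_congr fun k => ?_
        have hle : m ≤ k + (j + 1) := by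
          have := Finset.mem_range.1 hm
          omega
        have : ((k + (j + 1) : ℕ) : ℝ≥0∞) = ((k + (j + 1) - m : ℕ) : ℝ≥0∞) + m := by
          rw [← Nat.cast_add, Nat.sub_add_cancel hle]
        rw [this]
        ring
    _ = S * (r * T + r * a j) := by
        simp_rw [ENNReal.tsum_mul_left, hB]
        rw [← Finset.sum_mul]
    _ = (r * S) * T + r * a j * S := by ring
    _ = r * a j * (S + T) + A * T := by rw [← hA']; ring
    _ = r * a j + A * T := by rw [hST, mul_one]

theorem sq_sub_le_sum_Ico (g : ℕ → ℝ) {m n : ℕ} (h : m ≤ n) :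
    (g n - g m) ^ 2 ≤ (n - m : ℕ) * ∑ j ∈ Finset.Ico m n, (g (j + 1) - g j) ^ 2 := by
  rw [← Finset.sum_Ico_sub g h]
  have := sq_sum_le_card_mul_sum_sq (s := Finset.Ico m n) (f := fun j => g (j + 1) - g j)
  simpa using this

/-- Cauchy–Schwarz on the telescoping sum. Extending the sum to all `j` with an indicator prepares
the exchange of the sums over `m`, `n` and `j`. -/
theorem ofReal_sq_sub_le_tsum (g : ℕ → ℝ) {m n : ℕ} (h : m < n) :
    ENNReal.ofReal ((g n - g m) ^ 2) ≤ ∑' j : ℕ, if m ≤ j ∧ j < n then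
      ((n - m : ℕ) : ℝ≥0∞) * ENNReal.ofReal ((g (j + 1) - g j) ^ 2) else 0 := by
  refine (ENNReal.ofReal_le_ofReal (sq_sub_le_sum_Ico g h.le)).trans ?_
  rw [ENNReal.ofReal_mul (by positivity), ENNReal.ofReal_natCast,
    ENNReal.ofReal_sum_of_nonneg (fun _ _ => sq_nonneg _), Finset.mul_sum]
  refine le_trans (le_of_eq ?_) (ENNReal.sum_le_tsum (Finset.Ico m n))
  refine Finset.sum_congr rfl fun j hj => ?_
  rw [if_pos (Finset.mem_Ico.1 hj)]

theorem tsum_poissonMeasure_kernel (r : ℝ≥0) (j : ℕ) :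
    ∑' (m : ℕ) (n : ℕ), (if m ≤ j ∧ j < n then poissonMeasure r {m} * poissonMeasure r {n} *
      ((n - m : ℕ) : ℝ≥0∞) else 0) = r * poissonMeasure r {j} := by
  rw [← poissonMeasure_kernel r j, tsum_eq_sum (s := Finset.range (j + 1))]
  · refine Finset.sum_congr rfl fun m hm => ?_
    have hm' : m ≤ j := Nat.lt_succ_iff.1 (Finset.mem_range.1 hm)
    rw [← ENNReal.summable.sum_add_tsum_nat_add' (k := j + 1), Finset.sum_eq_zero, zero_add]
    · refine tsum_congr fun k => ?_
      rw [if_pos ⟨hm', by omega⟩]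
    · intro n hn
      rw [if_neg]
      have := Finset.mem_range.1 hn
      omega
  · intro m hm
    have : ¬ m ≤ j := fun h => hm (Finset.mem_range.2 (by omega))
    simp [this]

/-- By symmetry only pairs `m < n` matter, each counted twice. After telescoping, the coefficient of
the `j`-th squared increment is the kernel sum, so no constant is lost beyond Cauchy–Schwarz. -/
theorem lintegral_lintegral_sq_sub_poissonMeasure_le (r : ℝ≥0) (g : ℕ → ℝ) :
    ∫⁻ m, ∫⁻ n, ENNReal.ofReal ((g n - g m) ^ 2) ∂poissonMeasure r ∂poissonMeasure r ≤
      2 * (r * ∫⁻ n, ENNReal.ofReal ((g (n + 1) - g n) ^ 2) ∂poissonMeasure r) := by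
  set a : ℕ → ℝ≥0∞ := fun n => poissonMeasure r {n} with ha
  set d : ℕ → ℝ≥0∞ := fun j => ENNReal.ofReal ((g (j + 1) - g j) ^ 2) with hd
  have key : ∑' (m : ℕ) (n : ℕ), (if m < n then a m * a n * ENNReal.ofReal ((g n - g m) ^ 2)
      else 0) ≤ r * ∑' j, d j * a j := by
    calc ∑' (m : ℕ) (n : ℕ), (if m < n then a m * a n * ENNReal.ofReal ((g n - g m) ^ 2) else 0)
        ≤ ∑' (m : ℕ) (n : ℕ) (j : ℕ), d j * (if m ≤ j ∧ j < n then a m * a n *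
            ((n - m : ℕ) : ℝ≥0∞) else 0) := by
          refine ENNReal.tsum_le_tsum fun m => ENNReal.tsum_le_tsum fun n => ?_
          split_ifs with h
          · refine (mul_le_mul_right (ofReal_sq_sub_le_tsum g h) _).trans (le_of_eq ?_)
            rw [← ENNReal.tsum_mul_left]
            refine tsum_congr fun j => ?_
            split_ifs
            · ring
            · simp
          · exact zero_le
      _ = ∑' (j : ℕ) (m : ℕ) (n : ℕ), d j * (if m ≤ j ∧ j < n then a m * a n *
            ((n - m : ℕ) : ℝ≥0∞) else 0) := by
          rw [ENNReal.tsum_comm (f := fun j m => ∑' n, d j * (if m ≤ j ∧ j < n then a m * a n *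
            ((n - m : ℕ) : ℝ≥0∞) else 0))]
          exact tsum_congr fun m => ENNReal.tsum_comm
      _ = r * ∑' j, d j * a j := by
          rw [← ENNReal.tsum_mul_left]
          refine tsum_congr fun j => ?_
          simp_rw [ENNReal.tsum_mul_left]
          rw [tsum_poissonMeasure_kernel]
          simp only [ha]
          ring
  simp_rw [lintegral_countable']
  change ∑' m, (∑' n, ENNReal.ofReal ((g n - g m) ^ 2) * a n) * a m ≤
    2 * (r * ∑' j, d j * a j)
  refine le_trans (le_of_eq ?_) (mul_le_mul_right key 2)
  rw [two_mul]
  nth_rewrite 2 [ENNReal.tsum_comm]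
  rw [← ENNReal.tsum_add]
  refine tsum_congr fun m => ?_
  rw [← ENNReal.tsum_add, ← ENNReal.tsum_mul_right]
  refine tsum_congr fun n => ?_
  rcases lt_trichotomy m n with h | h | h
  · rw [if_pos h, if_neg h.not_gt]; ring
  · subst h; simp
  · rw [if_neg h.not_gt, if_pos h, zero_add, ← neg_sub, neg_sq]; ring

/-- Twice the variance as a double integral. -/
theorem integral_integral_sq_sub {X : Type*} [MeasurableSpace X] (ν : Measure X)
    [IsProbabilityMeasure ν] {g : X → ℝ} (hg : MemLp g 2 ν) :
    ∫ x, ∫ y, (g y - g x) ^ 2 ∂ν ∂ν = 2 * (∫ x, g x ^ 2 ∂ν - (∫ x, g x ∂ν) ^ 2) := by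
  have h1 : Integrable g ν := hg.integrable (by norm_num)
  have h2 : Integrable (fun x => g x ^ 2) ν := hg.integrable_sq
  have h3 : ∀ a b : ℝ, Integrable (fun y => a - 2 * g y * b) ν := fun a b =>
    (integrable_const _).sub ((h1.const_mul 2).mul_const _)
  have h4 : ∀ x, Integrable (fun y => g y ^ 2 - 2 * g x * g y) ν := fun x =>
    h2.sub (h1.const_mul _)
  have : ∀ x, ∫ y, (g y - g x) ^ 2 ∂ν = ∫ y, g y ^ 2 ∂ν - 2 * g x * ∫ y, g y ∂ν + g x ^ 2 := by
    intro x
    have e : (fun y => (g y - g x) ^ 2) = fun y => g y ^ 2 - 2 * g x * g y + g x ^ 2 := by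
      ext y; ring
    rw [e, integral_add (h4 x) (integrable_const _),
      integral_sub h2 (h1.const_mul _), integral_const_mul]
    simp
  simp_rw [this]
  rw [integral_add (h3 _ _) h2,
    integral_sub (integrable_const _) ((h1.const_mul 2).mul_const _), integral_mul_const,
    integral_const_mul]
  simp
  ring

theorem memLp_of_forall_abs_le {X : Type*} [MeasurableSpace X] (ν : Measure X)
    [IsFiniteMeasure ν] {g : X → ℝ} (hg : Measurable g) {M : ℝ} (hM : ∀ x, |g x| ≤ M)
    (p : ℝ≥0∞) : MemLp g p ν :=
  MemLp.of_bound hg.aestronglyMeasurable M (Filter.Eventually.of_forall hM)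

theorem poissonMeasure_poincare (r : ℝ≥0) (g : ℕ → ℝ) {M : ℝ} (hM : ∀ n, |g n| ≤ M) :
    ∫ n, g n ^ 2 ∂poissonMeasure r - (∫ n, g n ∂poissonMeasure r) ^ 2 ≤
      r * ∫ n, (g (n + 1) - g n) ^ 2 ∂poissonMeasure r := by
  have hM0 : 0 ≤ M := (abs_nonneg _).trans (hM 0)
  have hb : ∀ m n, |(g n - g m) ^ 2| ≤ (2 * M) ^ 2 := fun m n => by
    rw [abs_pow]
    have : |g n - g m| ≤ 2 * M := (abs_sub _ _).trans (by linarith [hM n, hM m])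
    gcongr
  have hi : ∀ m, Integrable (fun n => (g n - g m) ^ 2) (poissonMeasure r) := fun m =>
    memLp_one_iff_integrable.1 (memLp_of_forall_abs_le _ (by fun_prop) (hb m) 1)
  have hi2 : Integrable (fun n => (g (n + 1) - g n) ^ 2) (poissonMeasure r) :=
    memLp_one_iff_integrable.1 (memLp_of_forall_abs_le _ (by fun_prop) (fun n => hb n (n + 1)) 1)
  have h := lintegral_lintegral_sq_sub_poissonMeasure_le r g
  simp_rw [← ofReal_integral_eq_lintegral_ofReal (hi _)
    (Filter.Eventually.of_forall fun _ => sq_nonneg _)] at h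
  rw [← ofReal_integral_eq_lintegral_ofReal hi2
    (Filter.Eventually.of_forall fun _ => sq_nonneg _),
    ← ofReal_integral_eq_lintegral_ofReal ?_
    (Filter.Eventually.of_forall fun _ => integral_nonneg fun _ => sq_nonneg _),
    integral_integral_sq_sub _ (memLp_of_forall_abs_le _ (by fun_prop) hM 2),
    ← ENNReal.ofReal_coe_nnreal, ← ENNReal.ofReal_mul (by positivity),
    ← ENNReal.ofReal_ofNat, ← ENNReal.ofReal_mul (by positivity),
    ENNReal.ofReal_le_ofReal_iff] at h
  · linarith
  · have : 0 ≤ ∫ n, (g (n + 1) - g n) ^ 2 ∂poissonMeasure r := integral_nonneg fun _ => sq_nonneg _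
    positivity
  · refine memLp_one_iff_integrable.1 (memLp_of_forall_abs_le _ (measurable_of_countable _)
      (M := (2 * M) ^ 2) (fun m => ?_) 1)
    have := norm_integral_le_of_norm_le_const (μ := poissonMeasure r)
      (f := fun n => (g n - g m) ^ 2) (Filter.Eventually.of_forall (hb m))
    simpa using this

theorem sq_integral_le_integral_sq {X : Type*} [MeasurableSpace X] (ν : Measure X)
    [IsProbabilityMeasure ν] {g : X → ℝ} (hg : MemLp g 2 ν) :
    (∫ x, g x ∂ν) ^ 2 ≤ ∫ x, g x ^ 2 ∂ν := by
  have h := integral_integral_sq_sub ν hg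
  have : 0 ≤ ∫ x, ∫ y, (g y - g x) ^ 2 ∂ν ∂ν :=
    integral_nonneg fun _ => integral_nonneg fun _ => sq_nonneg _
  linarith

theorem integrable_of_forall_abs_le {X : Type*} [MeasurableSpace X] (ν : Measure X)
    [IsFiniteMeasure ν] {g : X → ℝ} (hg : Measurable g) {M : ℝ} (hM : ∀ x, |g x| ≤ M) :
    Integrable g ν :=
  memLp_one_iff_integrable.1 (memLp_of_forall_abs_le ν hg hM 1)

theorem abs_integral_le_of_forall_abs_le {X : Type*} [MeasurableSpace X] (ν : Measure X)
    [IsProbabilityMeasure ν] {g : X → ℝ} {M : ℝ} (hM : ∀ x, |g x| ≤ M) :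
    |∫ x, g x ∂ν| ≤ M := by
  have := norm_integral_le_of_norm_le_const (μ := ν) (f := g) (Filter.Eventually.of_forall hM)
  simpa using this

/-- The joint law of independent Poisson variables with parameters `r i`. -/
noncomputable abbrev poissonPi {k : ℕ} (r : Fin k → ℝ≥0) : Measure (Fin k → ℕ) :=
  Measure.pi fun i => poissonMeasure (r i)

theorem integral_poissonPi_succ {k : ℕ} (r : Fin (k + 1) → ℝ≥0) (g : (Fin (k + 1) → ℕ) → ℝ)
    {M : ℝ} (hM : ∀ n, |g n| ≤ M) :
    ∫ n, g n ∂poissonPi r = ∫ y, ∫ x, g (Fin.cons x y) ∂poissonMeasure (r 0)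
      ∂poissonPi fun i => r i.succ := by
  have h := (measurePreserving_piFinSuccAbove (fun i => poissonMeasure (r i)) 0).symm
  rw [← h.integral_comp']
  simp_rw [MeasurableEquiv.piFinSuccAbove_symm_apply, Fin.insertNthEquiv, Fin.insertNth_zero,
    Equiv.coe_fn_mk, Fin.zero_succAbove]
  rw [integral_prod_symm]
  · rfl
  · exact integrable_of_forall_abs_le _ (measurable_of_countable _) fun _ => hM _

/-- Tensorization by induction on the number of coordinates: the variance splits into the mean
conditional variance in coordinate `0` and the variance of the average `H` over that coordinate. The
former is the one-dimensional case; the latter is the induction hypothesis, since by Jensen the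
squared increments of `H` are at most the averaged squared increments of `g`. -/
theorem poissonPi_poincare {k : ℕ} (r : Fin k → ℝ≥0) (g : (Fin k → ℕ) → ℝ) {M : ℝ}
    (hM : ∀ n, |g n| ≤ M) :
    ∫ n, g n ^ 2 ∂poissonPi r - (∫ n, g n ∂poissonPi r) ^ 2 ≤
      ∑ i, r i * ∫ n, (g (n + Pi.single i 1) - g n) ^ 2 ∂poissonPi r := by
  induction k generalizing M with
  | zero =>
    have : ∀ h : (Fin 0 → ℕ) → ℝ, ∫ n, h n ∂poissonPi r = h default := fun h => by
      rw [poissonPi, Measure.pi_of_empty (x := default), integral_dirac]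
    simp [this]
  | succ k ih =>
    have hM0 : 0 ≤ M := (abs_nonneg _).trans (hM 0)
    have hsq : ∀ n, |g n ^ 2| ≤ M ^ 2 := fun n => by rw [abs_pow]; gcongr; exact hM n
    have hd : ∀ n n', |g n' - g n| ≤ 2 * M := fun n n' =>
      (abs_sub _ _).trans (by linarith [hM n, hM n'])
    have hdsq : ∀ n n', |(g n' - g n) ^ 2| ≤ (2 * M) ^ 2 := fun n n' => by
      rw [abs_pow]; gcongr; exact hd n n'
    have hm : ∀ h : ℕ → ℝ, Measurable h := fun h => measurable_of_countable h
    have hm' : ∀ h : (Fin k → ℕ) → ℝ, Measurable h := fun h => measurable_of_countable h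
    set r' : Fin k → ℝ≥0 := fun i => r i.succ
    set H : (Fin k → ℕ) → ℝ := fun y => ∫ x, g (Fin.cons x y) ∂poissonMeasure (r 0) with hH
    have hHM : ∀ y, |H y| ≤ M := fun y => abs_integral_le_of_forall_abs_le _ fun _ => hM _
    have hHsq : ∀ y, |H y ^ 2| ≤ M ^ 2 := fun n => by rw [abs_pow]; gcongr; exact hHM n
    have I1 : Integrable (fun y => ∫ x, g (Fin.cons x y) ^ 2 ∂poissonMeasure (r 0))
        (poissonPi r') := integrable_of_forall_abs_le _ (hm' _)
      fun y => abs_integral_le_of_forall_abs_le _ fun _ => hsq _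
    have I2 : Integrable (fun y => H y ^ 2) (poissonPi r') :=
      integrable_of_forall_abs_le _ (hm' _) hHsq
    have I3 : ∀ F : ℕ → (Fin k → ℕ) → (Fin (k + 1) → ℕ), Integrable (fun y =>
        ∫ x, (g (F x y) - g (Fin.cons x y)) ^ 2 ∂poissonMeasure (r 0)) (poissonPi r') :=
      fun F => integrable_of_forall_abs_le _ (hm' _)
        fun y => abs_integral_le_of_forall_abs_le _ fun _ => hdsq _ _
    have e0 : ∀ x (y : Fin k → ℕ), (Fin.cons x y + Pi.single 0 1 : Fin (k + 1) → ℕ) =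
        Fin.cons (x + 1) y := fun x y => by
      ext i
      refine Fin.cases ?_ (fun j => ?_) i <;> simp
    have e1 : ∀ x (y : Fin k → ℕ) (i : Fin k), (Fin.cons x y + Pi.single i.succ 1 :
        Fin (k + 1) → ℕ) = Fin.cons x (y + Pi.single i 1) := fun x y i => by
      ext l
      refine Fin.cases ?_ (fun j => ?_) l <;> simp [Pi.single_apply]
    rw [integral_poissonPi_succ r _ hsq, integral_poissonPi_succ r _ hM, Fin.sum_univ_succ]
    simp_rw [integral_poissonPi_succ r _ (fun n => hdsq n _), e0, e1]
    have A : ∫ y, ∫ x, g (Fin.cons x y) ^ 2 ∂poissonMeasure (r 0) ∂poissonPi r' -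
        ∫ y, H y ^ 2 ∂poissonPi r' ≤ r 0 * ∫ y, ∫ x, (g (Fin.cons (x + 1) y) -
          g (Fin.cons x y)) ^ 2 ∂poissonMeasure (r 0) ∂poissonPi r' := by
      rw [← integral_sub I1 I2, ← integral_const_mul]
      exact integral_mono (I1.sub I2) ((I3 fun x y => Fin.cons (x + 1) y).const_mul _) fun y =>
        poissonMeasure_poincare (r 0) (fun x => g (Fin.cons x y)) fun _ => hM _
    have B := ih r' H hHM
    have C : ∀ i, ∫ y, (H (y + Pi.single i 1) - H y) ^ 2 ∂poissonPi r' ≤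
        ∫ y, ∫ x, (g (Fin.cons x (y + Pi.single i 1)) - g (Fin.cons x y)) ^ 2
          ∂poissonMeasure (r 0) ∂poissonPi r' := fun i => by
      have hle : ∀ y, (H (y + Pi.single i 1) - H y) ^ 2 ≤
          ∫ x, (g (Fin.cons x (y + Pi.single i 1)) - g (Fin.cons x y)) ^ 2
            ∂poissonMeasure (r 0) := fun y => by
        simp only [hH]
        rw [← integral_sub (integrable_of_forall_abs_le _ (hm _) fun _ => hM _)
          (integrable_of_forall_abs_le _ (hm _) fun _ => hM _)]
        exact sq_integral_le_integral_sq _ (memLp_of_forall_abs_le _ (hm _) (fun _ => hd _ _) 2)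
      exact integral_mono_of_nonneg (Filter.Eventually.of_forall fun _ => sq_nonneg _)
        (I3 fun x y => Fin.cons x (y + Pi.single i 1)) (Filter.Eventually.of_forall hle)
    have D : ∑ i, r' i * ∫ y, (H (y + Pi.single i 1) - H y) ^ 2 ∂poissonPi r' ≤
        ∑ i, r' i * ∫ y, ∫ x, (g (Fin.cons x (y + Pi.single i 1)) - g (Fin.cons x y)) ^ 2
          ∂poissonMeasure (r 0) ∂poissonPi r' :=
      Finset.sum_le_sum fun i _ => mul_le_mul_of_nonneg_left (C i) (r' i).2
    linarith

/-! ### Cylinder sets and cylinder functions -/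

section Cylinder

variable {X ι : Type*} {mX : MeasurableSpace X} (φ : ι → X → ℝ≥0∞)

/-- The sets which depend on finitely many of the functions `φ i` only. -/
def cylinderSets : Set (Set X) :=
  {A | ∃ (T : Finset ι) (B : Set (T → ℝ≥0∞)), MeasurableSet B ∧
    A = (fun x (i : T) => φ i x) ⁻¹' B}

/-- The bounded functions which depend on finitely many of the functions `φ i` only. -/
def IsCylinderFunction (f : X → ℝ) : Prop :=
  ∃ (T : Finset ι) (g : (T → ℝ≥0∞) → ℝ), Measurable g ∧ (∃ M, ∀ x, |g x| ≤ M) ∧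
    f = fun x => g fun i => φ i x

theorem isSetAlgebra_cylinderSets : IsSetAlgebra (cylinderSets φ) where
  empty_mem := ⟨∅, ∅, MeasurableSet.empty, rfl⟩
  compl_mem := by
    rintro _ ⟨T, B, hB, rfl⟩
    exact ⟨T, Bᶜ, hB.compl, rfl⟩
  union_mem := by
    classical
    rintro _ _ ⟨T, B, hB, rfl⟩ ⟨T', B', hB', rfl⟩
    refine ⟨T ∪ T', Finset.restrict₂ (π := fun _ => ℝ≥0∞) Finset.subset_union_left ⁻¹' B ∪
      Finset.restrict₂ (π := fun _ => ℝ≥0∞) Finset.subset_union_right ⁻¹' B', ?_, rfl⟩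
    exact ((Finset.measurable_restrict₂ _) hB).union ((Finset.measurable_restrict₂ _) hB')

theorem IsCylinderFunction.add {φ : ι → X → ℝ≥0∞} {f f' : X → ℝ} (hf : IsCylinderFunction φ f)
    (hf' : IsCylinderFunction φ f') : IsCylinderFunction φ (f + f') := by
  classical
  obtain ⟨T, g, hg, ⟨M, hM⟩, rfl⟩ := hf
  obtain ⟨T', g', hg', ⟨M', hM'⟩, rfl⟩ := hf'
  refine ⟨T ∪ T', fun x => g (Finset.restrict₂ (π := fun _ => ℝ≥0∞) Finset.subset_union_left x) +
      g' (Finset.restrict₂ (π := fun _ => ℝ≥0∞) Finset.subset_union_right x), ?_,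
      ⟨M + M', fun x => (abs_add_le _ _).trans (add_le_add (hM _) (hM' _))⟩, rfl⟩
  exact (hg.comp (Finset.measurable_restrict₂ _)).add (hg'.comp (Finset.measurable_restrict₂ _))

variable {φ}

theorem IsCylinderFunction.measurable (hφ : ∀ i, Measurable (φ i)) {f : X → ℝ}
    (hf : IsCylinderFunction φ f) : Measurable f := by
  obtain ⟨T, g, hg, -, rfl⟩ := hf
  exact hg.comp (measurable_pi_lambda _ fun i => hφ i)

theorem generateFrom_cylinderSets (hφ : ∀ i, Measurable (φ i))
    (hle : mX ≤ ⨆ i, MeasurableSpace.comap (φ i) inferInstance) :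
    mX = MeasurableSpace.generateFrom (cylinderSets φ) := by
  apply le_antisymm
  · refine hle.trans (iSup_le fun i => ?_)
    rintro _ ⟨B, hB, rfl⟩
    refine MeasurableSpace.measurableSet_generateFrom
      ⟨{i}, (fun x => x ⟨i, Finset.mem_singleton_self i⟩) ⁻¹' B, ?_, rfl⟩
    exact (measurable_pi_apply _) hB
  · refine MeasurableSpace.generateFrom_le ?_
    rintro _ ⟨T, B, hB, rfl⟩
    exact (measurable_pi_lambda _ fun i : T => hφ i) hB

/-- Bounded cylinder functions are dense in `L^2`. -/
theorem exists_isCylinderFunction_eLpNorm_sub_le (hφ : ∀ i, Measurable (φ i))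
    (hle : mX ≤ ⨆ i, MeasurableSpace.comap (φ i) inferInstance) (ν : Measure X)
    [IsFiniteMeasure ν] {f : X → ℝ} (hf : MemLp f 2 ν) {ε : ℝ≥0∞} (hε : ε ≠ 0) :
    ∃ c, eLpNorm (f - c) 2 ν ≤ ε ∧ IsCylinderFunction φ c := by
  refine MemLp.induction_dense (by norm_num) (IsCylinderFunction φ) ?_
    (fun f g hf hg => hf.add hg) (fun f hf => (hf.measurable hφ).aestronglyMeasurable) hf hε
  intro a s hs _ ε hε
  obtain ⟨δ, hδ, h⟩ := exists_eLpNorm_indicator_le (μ := ν) (p := 2) (by norm_num) a hε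
  obtain ⟨_, ⟨T, B, hB, rfl⟩, ht⟩ := (Measure.MeasureDense.of_generateFrom_isSetAlgebra_finite ν
    (isSetAlgebra_cylinderSets φ) (generateFrom_cylinderSets hφ hle)).approx s hs
    (measure_ne_top _ _) δ (by exact_mod_cast hδ)
  refine ⟨((fun x (i : T) => φ i x) ⁻¹' B).indicator fun _ => a, ?_, T, B.indicator fun _ => a,
    measurable_const.indicator hB, ⟨|a|, fun x => ?_⟩, rfl⟩
  · rw [eLpNorm_indicator_sub_indicator, symmDiff_comm]
    exact h _ (by simpa using ht.le)
  · by_cases hx : x ∈ B <;> simp [hx]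

/-- Cylinder sets form a generating π-system, so finite-dimensional laws determine a probability
measure. -/
theorem ext_of_map_eq (hφ : ∀ i, Measurable (φ i))
    (hle : mX ≤ ⨆ i, MeasurableSpace.comap (φ i) inferInstance) (ν ν' : Measure X)
    [IsProbabilityMeasure ν] [IsProbabilityMeasure ν']
    (h : ∀ T : Finset ι, ν.map (fun x (i : T) => φ i x) = ν'.map (fun x (i : T) => φ i x)) :
    ν = ν' := by
  refine ext_of_generate_finite _ (generateFrom_cylinderSets hφ hle)
    (fun s hs t ht _ => (isSetAlgebra_cylinderSets φ).inter_mem hs ht) ?_ (by simp)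
  rintro _ ⟨T, B, hB, rfl⟩
  have hm : Measurable fun x (i : T) => φ i x := measurable_pi_lambda _ fun i : T => hφ i
  rw [← Measure.map_apply hm hB, ← Measure.map_apply hm hB, h T]

end Cylinder

/-! ### Measurable operations on counting measures -/

namespace CountingMeasure

variable {X U : Type*} [MeasurableSpace X] [MeasurableSpace U]

theorem measurable_eval {W : Set U} (hW : MeasurableSet W) :
    Measurable fun ξ : CountingMeasure U => (ξ : Measure U) W :=
  (Measure.measurable_coe hW).comp measurable_subtype_coe

theorem measurable_of_eval {f : X → CountingMeasure U}
    (h : ∀ W, MeasurableSet W → Measurable fun x => (f x : Measure U) W) : Measurable f :=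
  (Measure.measurable_of_measurable_coe _ h).subtype_mk

theorem measurable_addPoint :
    Measurable fun z : CountingMeasure U × U => z.1.addPoint z.2 := by
  refine measurable_of_eval fun W hW => ?_
  have : (fun z : CountingMeasure U × U => (z.1.addPoint z.2 : Measure U) W) =
      fun z => (z.1 : Measure U) W + W.indicator (fun _ => 1) z.2 := by
    ext z
    simp only [addPoint, Measure.add_apply, Measure.dirac_apply' _ hW]
    rfl
  rw [this]
  exact ((measurable_eval hW).comp measurable_fst).add
    ((measurable_const.indicator hW).comp measurable_snd)

variable {S : Set U} (hS : MeasurableSet S)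

/-- The configuration which agrees with `ξ` on `S` and with `ζ` off `S`. -/
noncomputable def glue (ξ ζ : CountingMeasure U) : CountingMeasure U :=
  ⟨(ξ : Measure U).restrict S + (ζ : Measure U).restrict Sᶜ, by
    obtain ⟨ξ, hσ, hξ⟩ := ξ
    obtain ⟨ζ, hσ', hζ⟩ := ζ
    refine ⟨inferInstanceAs (SigmaFinite (ξ.restrict S + ζ.restrict Sᶜ)), fun W hW => ?_⟩
    rw [Measure.add_apply, Measure.restrict_apply hW, Measure.restrict_apply hW]
    rcases hξ _ (hW.inter hS) with h | ⟨n, h⟩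
    · simp [h]
    rcases hζ _ (hW.inter hS.compl) with h' | ⟨n', h'⟩
    · simp [h']
    · exact Or.inr ⟨n + n', by simp [h, h']⟩⟩

/-- The restriction of a configuration to `S`. -/
noncomputable def restrict (ξ : CountingMeasure U) : CountingMeasure U :=
  ⟨(ξ : Measure U).restrict S, by
    obtain ⟨ξ, hσ, hξ⟩ := ξ
    refine ⟨inferInstanceAs (SigmaFinite (ξ.restrict S)), fun W hW => ?_⟩
    rw [Measure.restrict_apply hW]
    exact hξ _ (hW.inter hS)⟩

theorem restrict_apply (ξ : CountingMeasure U) {W : Set U} (hW : MeasurableSet W) :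
    (ξ.restrict hS : Measure U) W = (ξ : Measure U) (W ∩ S) :=
  Measure.restrict_apply hW

theorem glue_apply (ξ ζ : CountingMeasure U) {W : Set U} (hW : MeasurableSet W) :
    (glue hS ξ ζ : Measure U) W = (ξ : Measure U) (W ∩ S) + (ζ : Measure U) (W ∩ Sᶜ) := by
  simp only [glue, Measure.add_apply, Measure.restrict_apply hW]

theorem addPoint_apply (ξ : CountingMeasure U) (u : U) {W : Set U} (hW : MeasurableSet W) :
    (ξ.addPoint u : Measure U) W = (ξ : Measure U) W + W.indicator 1 u := by
  simp only [addPoint, Measure.add_apply, Measure.dirac_apply' _ hW]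

theorem ext_of_measurableSet {ξ ζ : CountingMeasure U}
    (h : ∀ W, MeasurableSet W → (ξ : Measure U) W = (ζ : Measure U) W) : ξ = ζ :=
  Subtype.ext (Measure.ext h)

theorem measurable_restrict : Measurable (restrict hS) :=
  measurable_of_eval fun W hW => by
    simp_rw [restrict_apply hS _ hW]
    exact measurable_eval (hW.inter hS)

theorem measurable_glue : Measurable fun z : CountingMeasure U × CountingMeasure U =>
    glue hS z.1 z.2 :=
  measurable_of_eval fun W hW => by
    simp_rw [glue_apply hS _ _ hW]
    exact ((measurable_eval (hW.inter hS)).comp measurable_fst).add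
      ((measurable_eval (hW.inter hS.compl)).comp measurable_snd)

theorem glue_restrict (ξ ζ : CountingMeasure U) : glue hS (ξ.restrict hS) ζ = glue hS ξ ζ :=
  ext_of_measurableSet fun W hW => by
    rw [glue_apply hS _ _ hW, glue_apply hS _ _ hW, restrict_apply hS _ (hW.inter hS),
      Set.inter_assoc, Set.inter_self]

/-- This makes `D_u`, for `u ∈ S`, commute with freezing the configuration outside `S`. -/
theorem glue_addPoint (ξ ζ : CountingMeasure U) {u : U} (hu : u ∈ S) :
    glue hS (ξ.addPoint u) ζ = (glue hS ξ ζ).addPoint u :=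
  ext_of_measurableSet fun W hW => by
    rw [glue_apply hS _ _ hW, addPoint_apply _ _ hW, glue_apply hS _ _ hW,
      addPoint_apply _ _ (hW.inter hS), add_right_comm]
    have : (W ∩ S).indicator (1 : U → ℝ≥0∞) u = W.indicator 1 u := by
      by_cases h : u ∈ W <;> simp [h, hu]
    rw [this]

/-- A criterion for a subfamily of evaluations to generate the σ-algebra. It serves both for all
measurable sets and for sets cut down to the spanning sets of `μ`. -/
theorem measurableSpace_le_iSup {ι : Type*} {W : ι → Set U}
    (h : ∀ V, MeasurableSet V →
      Measurable[⨆ i, MeasurableSpace.comap (fun ξ : CountingMeasure U => (ξ : Measure U) (W i))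
        inferInstance] fun ξ : CountingMeasure U => (ξ : Measure U) V) :
    (inferInstance : MeasurableSpace (CountingMeasure U)) ≤
      ⨆ i, MeasurableSpace.comap (fun ξ : CountingMeasure U => (ξ : Measure U) (W i))
        inferInstance := by
  refine (measurableSpace_eq U).trans_le (iSup₂_le fun V hV => ?_)
  rw [← BorelSpace.measurable_eq (α := ℝ≥0∞)]
  exact (h V hV).comap_le

end CountingMeasure

/-! ### Atoms of a finite family of sets -/

section Atoms

variable {U κ : Type*} {W : κ → Set U}

/-- The atom of the points which belong to `W i` exactly for `i ∈ b`. -/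
def atom (W : κ → Set U) (b : Set κ) : Set U := {u | ∀ i, u ∈ W i ↔ i ∈ b}

theorem measurableSet_atom [MeasurableSpace U] [Finite κ] (hW : ∀ i, MeasurableSet (W i)) (b : Set κ) :
    MeasurableSet (atom W b) := by
  have : atom W b = ⋂ i, {u | u ∈ W i ↔ i ∈ b} := by ext; simp [atom]
  rw [this]
  refine MeasurableSet.iInter fun i => ?_
  by_cases hi : i ∈ b
  · simpa [hi] using hW i
  · simp only [hi, iff_false]
    exact (hW i).compl

theorem disjoint_atom {b b' : Set κ} (h : b ≠ b') : Disjoint (atom W b) (atom W b') :=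
  Set.disjoint_left.2 fun _ hu hu' => h (Set.ext fun i => (hu i).symm.trans (hu' i))

-- Each point lies in exactly one atom, the one indexed by `{j | u ∈ W j}`. Counts in overlapping
-- sets thus become linear functions of counts in disjoint sets.
open Classical in
theorem measure_inter_eq_sum_atom [MeasurableSpace U] [Finite κ] [Fintype (Set κ)] (hW : ∀ i, MeasurableSet (W i)) {S : Set U}
    (hS : MeasurableSet S) (ν : Measure U) (i : κ) :
    ν (W i ∩ S) = ∑ b : Set κ, if i ∈ b then ν (atom W b ∩ S) else 0 := by
  rw [← Finset.sum_filter, ← measure_biUnion_finset]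
  · congr 1
    ext u
    simp only [Finset.mem_filter, Finset.mem_univ, true_and, Set.mem_iUnion, Set.mem_inter_iff,
      exists_prop]
    constructor
    · rintro ⟨h1, h2⟩
      exact ⟨{j | u ∈ W j}, h1, fun j => Iff.rfl, h2⟩
    · rintro ⟨b, hb, h1, h2⟩
      exact ⟨(h1 i).2 hb, h2⟩
  · intro b _ b' _ h
    exact (disjoint_atom h).mono Set.inter_subset_left Set.inter_subset_left
  · exact fun b _ => (measurableSet_atom hW b).inter hS

end Atoms

/-! ### Independence properties of the Poisson process -/

namespace IsPoissonProcess

variable {Ω U : Type*} [MeasurableSpace Ω] [MeasurableSpace U] {η : Ω → CountingMeasure U}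
  {μ : Measure U} {P : Measure Ω}

theorem iIndepFun_eval (h : IsPoissonProcess η μ P) {ι : Type*} [Finite ι] {A : ι → Set U}
    (hA : ∀ i, MeasurableSet (A i)) (hd : Pairwise fun i j => Disjoint (A i) (A j)) :
    iIndepFun (fun i ω => (η ω : Measure U) (A i)) P := by
  obtain ⟨n, ⟨e⟩⟩ := Finite.exists_equiv_fin ι
  have := h.indep n (fun j => A (e.symm j)) (fun j => hA _)
    fun i j hij => hd (e.symm.injective.ne hij)
  simpa using this.precomp e.injective

theorem measurable_eval (h : IsPoissonProcess η μ P) {W : Set U} (hW : MeasurableSet W) :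
    Measurable fun ω => (η ω : Measure U) W :=
  (CountingMeasure.measurable_eval hW).comp h.measurable

/-- Independence is postulated only for disjoint sets. Cutting the atoms of `W` by `S` and `Sᶜ`
gives a disjoint family, and the two vectors are functions of complementary blocks of its counts. -/
theorem indepFun_inter_inter_compl (h : IsPoissonProcess η μ P) {κ : Type*} [Finite κ]
    {W : κ → Set U} (hW : ∀ i, MeasurableSet (W i)) {S : Set U} (hS : MeasurableSet S) :
    IndepFun (fun ω i => (η ω : Measure U) (W i ∩ S)) (fun ω i => (η ω : Measure U) (W i ∩ Sᶜ))
      P := by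
  classical
  cases nonempty_fintype κ
  let A : Set κ × Bool → Set U := fun b => atom W b.1 ∩ bif b.2 then S else Sᶜ
  have hA : ∀ b, MeasurableSet (A b) := by
    rintro ⟨b, _ | _⟩
    · exact (measurableSet_atom hW b).inter hS.compl
    · exact (measurableSet_atom hW b).inter hS
  have hd : Pairwise fun b b' => Disjoint (A b) (A b') := by
    rintro ⟨b, s⟩ ⟨b', s'⟩ hne
    by_cases hb : b = b'
    · subst hb
      have hs : s ≠ s' := fun hs => hne (by rw [hs])
      refine Disjoint.mono Set.inter_subset_right Set.inter_subset_right ?_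
      cases s <;> cases s' <;> simp_all [disjoint_compl_left, disjoint_compl_right]
    · exact (disjoint_atom hb).mono Set.inter_subset_left Set.inter_subset_left
  let I : Bool → Finset (Set κ × Bool) := fun s => Finset.univ.filter fun b => b.2 = s
  have key := (h.iIndepFun_eval hA hd).indepFun_finset (I true) (I false)
    (Finset.disjoint_filter.2 fun b _ hb => by simp [hb]) (fun b => h.measurable_eval (hA b))
  let φ : ∀ s : Bool, (I s → ℝ≥0∞) → κ → ℝ≥0∞ := fun s x i =>
    ∑ b : Set κ, if i ∈ b then x ⟨(b, s), by simp [I]⟩ else 0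
  have hφ : ∀ s, Measurable (φ s) := fun s =>
    measurable_pi_lambda _ fun i => Finset.measurable_sum _ fun b _ => by
      split_ifs
      · exact measurable_pi_apply _
      · exact measurable_const
  have key' := key.comp (hφ true) (hφ false)
  convert key' using 1
  · ext ω i
    exact measure_inter_eq_sum_atom hW hS _ i
  · ext ω i
    exact measure_inter_eq_sum_atom hW hS.compl _ i

/-- The defining conditions involve only joint laws of counts, so the proof can be carried out on
configuration space under the law of `η`. -/
theorem isPoissonProcess_id_map [IsProbabilityMeasure P] (h : IsPoissonProcess η μ P) :
    IsPoissonProcess id μ (P.map η) where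
  measurable := measurable_id
  law W hW := by
    simp only [id]
    rw [← h.law W hW, Measure.map_map (CountingMeasure.measurable_eval hW) h.measurable]
    rfl
  indep m W hW hd := by
    have := Measure.isProbabilityMeasure_map (μ := P) h.measurable.aemeasurable
    simp only [id]
    rw [iIndepFun_iff_map_fun_eq_pi_map
      fun i => (CountingMeasure.measurable_eval (hW i)).aemeasurable]
    have h1 := (iIndepFun_iff_map_fun_eq_pi_map
      fun i => (h.measurable_eval (hW i)).aemeasurable).1 (h.indep m W hW hd)
    rw [Measure.map_map (measurable_pi_lambda _ fun i => CountingMeasure.measurable_eval (hW i))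
      h.measurable]
    refine h1.trans ?_
    congr 1
    ext1 i
    rw [Measure.map_map (CountingMeasure.measurable_eval (hW i)) h.measurable]
    rfl

variable {L : Measure (CountingMeasure U)} [IsProbabilityMeasure L]

/-- Counts inside and outside `S` are independent, so taking them from two independent copies does
not change the finite-dimensional laws. -/
theorem map_glue (h : IsPoissonProcess id μ L) {S : Set U} (hS : MeasurableSet S) :
    (L.prod L).map (fun z => CountingMeasure.glue hS z.1 z.2) = L := by
  have hg := CountingMeasure.measurable_glue hS
  have := Measure.isProbabilityMeasure_map (μ := L.prod L) hg.aemeasurable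
  refine ext_of_map_eq (φ := fun (W : {W : Set U // MeasurableSet W}) (ξ : CountingMeasure U) =>
    (ξ : Measure U) W) (fun W => CountingMeasure.measurable_eval W.2)
    (CountingMeasure.measurableSpace_le_iSup fun V hV => ?_) _ _ fun T => ?_
  · exact Measurable.mono (comap_measurable _) (le_iSup (fun W : {W : Set U // MeasurableSet W} =>
      MeasurableSpace.comap (fun ξ : CountingMeasure U => (ξ : Measure U) W) inferInstance)
      ⟨V, hV⟩) le_rfl
  · have mE : Measurable fun (ξ : CountingMeasure U) (W : T) => (ξ : Measure U) W :=
      measurable_pi_lambda _ fun W => CountingMeasure.measurable_eval W.1.2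
    have mX : Measurable fun (ξ : CountingMeasure U) (W : T) => (ξ : Measure U) (W ∩ S) :=
      measurable_pi_lambda _ fun W => CountingMeasure.measurable_eval (W.1.2.inter hS)
    have mY : Measurable fun (ξ : CountingMeasure U) (W : T) => (ξ : Measure U) (W ∩ Sᶜ) :=
      measurable_pi_lambda _ fun W => CountingMeasure.measurable_eval (W.1.2.inter hS.compl)
    have hind := h.indepFun_inter_inter_compl (fun W : T => W.1.2) hS
    have hind' := (indepFun_iff_map_prod_eq_prod_map_map mX.aemeasurable mY.aemeasurable).1 hind
    rw [Measure.map_map mE hg]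
    have e1 : ((fun (ξ : CountingMeasure U) (W : T) => (ξ : Measure U) W) ∘
        fun z : CountingMeasure U × CountingMeasure U => CountingMeasure.glue hS z.1 z.2) =
        (fun w : (T → ℝ≥0∞) × (T → ℝ≥0∞) => w.1 + w.2) ∘
          Prod.map (fun (ξ : CountingMeasure U) (W : T) => (ξ : Measure U) (W ∩ S))
            (fun (ξ : CountingMeasure U) (W : T) => (ξ : Measure U) (W ∩ Sᶜ)) := by
      ext z W
      exact CountingMeasure.glue_apply hS _ _ W.1.2
    have e2 : (fun (ξ : CountingMeasure U) (W : T) => (ξ : Measure U) W) =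
        (fun w : (T → ℝ≥0∞) × (T → ℝ≥0∞) => w.1 + w.2) ∘
          fun ξ : CountingMeasure U => ((fun W : T => (ξ : Measure U) (W ∩ S)),
            fun W : T => (ξ : Measure U) (W ∩ Sᶜ)) := by
      ext ξ W
      exact (measure_inter_add_sdiff _ hS).symm
    rw [e1, e2, ← Measure.map_map (by fun_prop) (mX.prodMap mY),
      ← Measure.map_map (by fun_prop) (mX.prodMk mY), ← Measure.map_prod_map _ _ mX mY]
    congr 1
    exact hind'.symm

end IsPoissonProcess

/-! ### The `L^2` Poincaré inequality for the Poisson process -/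

theorem eLpNorm_two_pow_two {X : Type*} [MeasurableSpace X] (ν : Measure X) (f : X → ℝ) :
    eLpNorm f 2 ν ^ 2 = ∫⁻ x, ‖f x‖ₑ ^ 2 ∂ν := by
  have h := eLpNorm_nnreal_pow_eq_lintegral (μ := ν) (f := f) (p := 2) (by norm_num)
  simpa using h

theorem eLpNorm_two_le_of_lintegral_le {X Y : Type*} [MeasurableSpace X] [MeasurableSpace Y]
    {ν : Measure X} {ν' : Measure Y} {f : X → ℝ} {g : Y → ℝ}
    (h : ∫⁻ x, ‖f x‖ₑ ^ 2 ∂ν ≤ ∫⁻ y, ‖g y‖ₑ ^ 2 ∂ν') : eLpNorm f 2 ν ≤ eLpNorm g 2 ν' := by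
  rw [← eLpNorm_two_pow_two, ← eLpNorm_two_pow_two] at h
  exact (ENNReal.pow_le_pow_left_iff (by norm_num)).1 h

theorem enorm_sq_eq_ofReal (x : ℝ) : ‖x‖ₑ ^ 2 = ENNReal.ofReal (x ^ 2) := by
  rw [Real.enorm_eq_ofReal_abs, ← ENNReal.ofReal_pow (abs_nonneg x), sq_abs]

/-- The mean is controlled by the `L^2` norm. -/
theorem enorm_integral_le_eLpNorm_two {X : Type*} [MeasurableSpace X] (ν : Measure X)
    [IsProbabilityMeasure ν] {f : X → ℝ} (hf : AEStronglyMeasurable f ν) :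
    ‖∫ x, f x ∂ν‖ₑ ≤ eLpNorm f 2 ν := by
  refine (enorm_integral_le_lintegral_enorm f).trans ?_
  rw [← eLpNorm_one_eq_lintegral_enorm]
  exact eLpNorm_le_eLpNorm_of_exponent_le (by norm_num) hf

theorem eLpNorm_const_two {X : Type*} [MeasurableSpace X] (ν : Measure X)
    [IsProbabilityMeasure ν] (a : ℝ) : eLpNorm (fun _ : X => a) 2 ν = ‖a‖ₑ := by
  rw [eLpNorm_const _ (by norm_num) (IsProbabilityMeasure.ne_zero ν)]
  simp

/-- The variance is stable under perturbations in `L^2`. -/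
theorem eLpNorm_sub_integral_le {X : Type*} [MeasurableSpace X] (ν : Measure X)
    [IsProbabilityMeasure ν] {f c : X → ℝ} (hf : MemLp f 2 ν) (hc : MemLp c 2 ν) :
    eLpNorm (fun x => f x - ∫ y, f y ∂ν) 2 ν ≤
      eLpNorm (fun x => c x - ∫ y, c y ∂ν) 2 ν + 2 * eLpNorm (fun x => f x - c x) 2 ν := by
  set a := ∫ y, f y ∂ν with ha
  set b := ∫ y, c y ∂ν with hb
  have hab : ∫ y, (f y - c y) ∂ν = a - b :=
    integral_sub (hf.integrable (by norm_num)) (hc.integrable (by norm_num))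
  have m1 : AEStronglyMeasurable (fun x => f x - c x) ν :=
    hf.aestronglyMeasurable.sub hc.aestronglyMeasurable
  have m2 : AEStronglyMeasurable (fun x => c x - b) ν :=
    hc.aestronglyMeasurable.sub aestronglyMeasurable_const
  have h1 := eLpNorm_sub_le m1 (aestronglyMeasurable_const (b := a - b)) (p := 2) (by norm_num)
  have h2 := eLpNorm_add_le m2 (m1.sub (aestronglyMeasurable_const (b := a - b))) (p := 2)
    (by norm_num)
  have h3 := enorm_integral_le_eLpNorm_two ν m1
  rw [hab] at h3
  rw [eLpNorm_const_two] at h1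
  have e : (fun x => f x - a) = (fun x => c x - b) + ((fun x => f x - c x) - fun _ => a - b) := by
    ext x
    simp only [Pi.add_apply, Pi.sub_apply]
    ring
  rw [e]
  refine h2.trans (add_le_add le_rfl (h1.trans ?_))
  rw [two_mul]
  exact add_le_add le_rfl h3

theorem measurable_diffOp {U : Type*} [MeasurableSpace U] {f : CountingMeasure U → ℝ}
    (hf : Measurable f) : Measurable fun z : CountingMeasure U × U => diffOp z.2 f z.1 :=
  (hf.comp CountingMeasure.measurable_addPoint).sub (hf.comp measurable_fst)

/-- The numbers of points of a configuration in the sets `A i`. -/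
def CountingMeasure.counts {U ι : Type*} [MeasurableSpace U] (A : ι → Set U)
    (ξ : CountingMeasure U) : ι → ℝ≥0∞ := fun i => (ξ : Measure U) (A i)

theorem CountingMeasure.measurable_counts {U ι : Type*} [MeasurableSpace U] {A : ι → Set U}
    (hA : ∀ i, MeasurableSet (A i)) : Measurable (CountingMeasure.counts A) :=
  measurable_pi_lambda _ fun i => CountingMeasure.measurable_eval (hA i)

/-! ### Poincaré inequality for functions of finitely many counts -/

namespace IsPoissonProcess

variable {U : Type*} [MeasurableSpace U] {μ : Measure U} {L : Measure (CountingMeasure U)}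
  [IsProbabilityMeasure L]

theorem map_eval_eq_map_poissonPi (h : IsPoissonProcess id μ L) {k : ℕ} {A : Fin k → Set U}
    (hA : ∀ i, MeasurableSet (A i)) (hd : Pairwise fun i j => Disjoint (A i) (A j))
    (hfin : ∀ i, μ (A i) ≠ ∞) :
    L.map (CountingMeasure.counts A) =
      (poissonPi fun i => (μ (A i)).toNNReal).map fun n i => (n i : ℝ≥0∞) := by
  have h1 := (iIndepFun_iff_map_fun_eq_pi_map
      fun i => (h.measurable_eval (hA i)).aemeasurable).1 (h.iIndepFun_eval hA hd)
  refine h1.trans ?_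
  simp_rw [fun i => h.law (A i) (hA i), extPoissonMeasure, if_neg (hfin _)]
  have hp : ∀ r : ℝ≥0, IsProbabilityMeasure ((poissonMeasure r).map fun n : ℕ => (n : ℝ≥0∞)) :=
    fun r => Measure.isProbabilityMeasure_map (by fun_prop)
  exact (Measure.pi_map_pi (f := fun (_ : Fin k) (n : ℕ) => (n : ℝ≥0∞))
    fun i => by fun_prop).symm

theorem integral_eval_eq (h : IsPoissonProcess id μ L) {k : ℕ} {A : Fin k → Set U}
    (hA : ∀ i, MeasurableSet (A i)) (hd : Pairwise fun i j => Disjoint (A i) (A j))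
    (hfin : ∀ i, μ (A i) ≠ ∞) {G : (Fin k → ℝ≥0∞) → ℝ} (hG : Measurable G) :
    ∫ ξ, G (ξ.counts A) ∂L =
      ∫ n, G (fun i => (n i : ℝ≥0∞)) ∂poissonPi fun i => (μ (A i)).toNNReal := by
  have mY := CountingMeasure.measurable_counts hA
  have mc : Measurable fun (n : Fin k → ℕ) i => (n i : ℝ≥0∞) := by fun_prop
  rw [← integral_map (φ := CountingMeasure.counts A) (f := G)
    mY.aemeasurable hG.aestronglyMeasurable, h.map_eval_eq_map_poissonPi hA hd hfin,
    integral_map mc.aemeasurable hG.aestronglyMeasurable]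

theorem poincare_eval (h : IsPoissonProcess id μ L) {k : ℕ} {A : Fin k → Set U}
    (hA : ∀ i, MeasurableSet (A i)) (hd : Pairwise fun i j => Disjoint (A i) (A j))
    (hfin : ∀ i, μ (A i) ≠ ∞) {g : (Fin k → ℝ≥0∞) → ℝ} (hg : Measurable g) {M : ℝ}
    (hM : ∀ x, |g x| ≤ M) :
    ∫ ξ, g (ξ.counts A) ^ 2 ∂L -
        (∫ ξ, g (ξ.counts A) ∂L) ^ 2 ≤
      ∑ i, (μ (A i)).toReal * ∫ ξ, (g (ξ.counts A + Pi.single i 1) -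
        g (ξ.counts A)) ^ 2 ∂L := by
  rw [h.integral_eval_eq hA hd hfin hg,
    h.integral_eval_eq hA hd hfin (G := fun x => g x ^ 2) (hg.pow_const 2)]
  have e : ∀ i : Fin k, _ := fun i => h.integral_eval_eq hA hd hfin
    (G := fun x => (g (x + Pi.single i 1) - g x) ^ 2)
    (((hg.comp (measurable_id.add_const _)).sub hg).pow_const 2)
  simp_rw [e]
  refine (poissonPi_poincare _ (fun n => g fun i => (n i : ℝ≥0∞)) fun n => hM _).trans
    (le_of_eq ?_)
  refine Finset.sum_congr rfl fun i _ => ?_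
  have e2 : ∀ n : Fin k → ℕ, (fun j => (((n + Pi.single i 1 : Fin k → ℕ) j : ℕ) : ℝ≥0∞)) =
      (fun j => (n j : ℝ≥0∞)) + Pi.single i 1 := fun n => by
    ext j
    by_cases hj : j = i
    · subst hj; simp
    · simp [hj]
  simp_rw [e2]
  rfl

/-- A point added in `A i` raises the `i`-th count by one and leaves the others unchanged. Hence
`D_u c` does not depend on `u ∈ A i`, and the factor `μ (A i)` of the discrete inequality becomes an
integral over `A i`. -/
theorem poincare_eval_eLpNorm [SigmaFinite μ] (h : IsPoissonProcess id μ L) {k : ℕ}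
    {A : Fin k → Set U} (hA : ∀ i, MeasurableSet (A i))
    (hd : Pairwise fun i j => Disjoint (A i) (A j))
    (hfin : ∀ i, μ (A i) ≠ ∞) {g : (Fin k → ℝ≥0∞) → ℝ} (hg : Measurable g) {M : ℝ}
    (hM : ∀ x, |g x| ≤ M) {S : Set U} (hAS : ∀ i, A i ⊆ S)
    {c : CountingMeasure U → ℝ} (hc : c = fun ξ => g (ξ.counts A)) :
    eLpNorm (fun ξ => c ξ - ∫ ζ, c ζ ∂L) 2 L ≤
      eLpNorm (fun z : CountingMeasure U × U => diffOp z.2 c z.1) 2 (L.prod (μ.restrict S)) := by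
  have mY := CountingMeasure.measurable_counts hA
  have mc : Measurable c := hc ▸ hg.comp mY
  have hcM : ∀ ξ, |c ξ| ≤ M := fun ξ => by rw [hc]; exact hM _
  have hcL : MemLp c 2 L := memLp_of_forall_abs_le _ mc hcM 2
  have hdiff : ∀ i, ∀ u ∈ A i, ∀ ξ, diffOp u c ξ =
      g (ξ.counts A + Pi.single i 1) -
        g (ξ.counts A) := fun i u hu ξ => by
    simp only [diffOp, hc]
    congr 2
    ext j
    rw [CountingMeasure.counts, CountingMeasure.addPoint_apply _ _ (hA j), Pi.add_apply]
    congr 1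
    by_cases hj : j = i
    · subst hj; simp [hu]
    · rw [Pi.single_eq_of_ne hj, Set.indicator_of_notMem]
      exact Set.disjoint_left.1 (hd (Ne.symm hj)) hu
  refine eLpNorm_two_le_of_lintegral_le ?_
  have hdm : Measurable fun z : CountingMeasure U × U => ‖diffOp z.2 c z.1‖ₑ ^ 2 :=
    (measurable_diffOp mc).enorm.pow_const 2
  rw [lintegral_prod_symm _ hdm.aemeasurable]
  have hM0 : 0 ≤ M := (abs_nonneg _).trans (hM 0)
  have hint : ∀ i, Integrable (fun ξ : CountingMeasure U =>
      (g (ξ.counts A + Pi.single i 1) -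
        g (ξ.counts A)) ^ 2) L := fun i => by
    refine integrable_of_forall_abs_le L (M := (2 * M) ^ 2) ?_ fun ξ => ?_
    · exact ((hg.comp (mY.add_const _)).sub (hg.comp mY)).pow_const 2
    · rw [abs_pow]
      have h1 := hM (ξ.counts A + Pi.single i 1)
      have h2 := hM (ξ.counts A)
      have h3 : |g (ξ.counts A + Pi.single i 1) - g (ξ.counts A)| ≤ 2 * M :=
        (abs_sub _ _).trans (by linarith)
      gcongr
  have hvar : ∫ ξ, (c ξ - ∫ ζ, c ζ ∂L) ^ 2 ∂L = ∫ ξ, c ξ ^ 2 ∂L - (∫ ξ, c ξ ∂L) ^ 2 := by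
    have := variance_eq_integral mc.aemeasurable (μ := L)
    rw [← this, variance_eq_sub hcL]
    rfl
  calc ∫⁻ ξ, ‖c ξ - ∫ ζ, c ζ ∂L‖ₑ ^ 2 ∂L
      = ENNReal.ofReal (∫ ξ, c ξ ^ 2 ∂L - (∫ ξ, c ξ ∂L) ^ 2) := by
        simp_rw [enorm_sq_eq_ofReal]
        rw [← hvar, ofReal_integral_eq_lintegral_ofReal]
        · exact (hcL.sub (memLp_const _)).integrable_sq
        · exact Filter.Eventually.of_forall fun _ => sq_nonneg _
    _ ≤ ENNReal.ofReal (∑ i, (μ (A i)).toReal *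
          ∫ ξ, (g (ξ.counts A + Pi.single i 1) -
            g (ξ.counts A)) ^ 2 ∂L) := by
        refine ENNReal.ofReal_le_ofReal ?_
        simp only [hc]
        exact h.poincare_eval hA hd hfin hg hM
    _ = ∑ i, ∫⁻ u in A i, ∫⁻ ξ, ‖diffOp u c ξ‖ₑ ^ 2 ∂L ∂μ := by
        rw [ENNReal.ofReal_sum_of_nonneg fun i _ => mul_nonneg ENNReal.toReal_nonneg
          (integral_nonneg fun _ => sq_nonneg _)]
        refine Finset.sum_congr rfl fun i _ => ?_
        rw [setLIntegral_congr_fun (hA i) (g := fun _ => ∫⁻ ξ : CountingMeasure U,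
          ENNReal.ofReal ((g (ξ.counts A + Pi.single i 1) -
            g (ξ.counts A)) ^ 2) ∂L) fun u hu => by
              simp only [enorm_sq_eq_ofReal, hdiff i u hu],
          setLIntegral_const, ENNReal.ofReal_mul ENNReal.toReal_nonneg,
          ENNReal.ofReal_toReal (hfin i), mul_comm,
          ofReal_integral_eq_lintegral_ofReal (hint i)
            (Filter.Eventually.of_forall fun _ => sq_nonneg _)]
    _ = ∫⁻ u in ⋃ i, A i, ∫⁻ ξ, ‖diffOp u c ξ‖ₑ ^ 2 ∂L ∂μ := by
        rw [lintegral_iUnion hA hd, tsum_fintype]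
    _ ≤ ∫⁻ u in S, ∫⁻ ξ, ‖diffOp u c ξ‖ₑ ^ 2 ∂L ∂μ :=
        lintegral_mono_set (Set.iUnion_subset hAS)

/-- The disjoint case applies to the atoms of `W` intersected with `S`; the counts in `W i ∩ S` are
sums of the atom counts. -/
theorem poincare_of_eval_inter [SigmaFinite μ] (h : IsPoissonProcess id μ L) {κ : Type*} [Finite κ]
    {W : κ → Set U} (hW : ∀ i, MeasurableSet (W i)) {S : Set U} (hS : MeasurableSet S)
    (hfin : μ S ≠ ∞) {g : (κ → ℝ≥0∞) → ℝ} (hg : Measurable g) {M : ℝ} (hM : ∀ x, |g x| ≤ M)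
    {c : CountingMeasure U → ℝ} (hc : c = fun ξ => g (ξ.counts fun i => W i ∩ S)) :
    eLpNorm (fun ξ => c ξ - ∫ ζ, c ζ ∂L) 2 L ≤
      eLpNorm (fun z : CountingMeasure U × U => diffOp z.2 c z.1) 2 (L.prod (μ.restrict S)) := by
  classical
  cases nonempty_fintype κ
  let e := Fintype.equivFin (Set κ)
  refine h.poincare_eval_eLpNorm (A := fun j => atom W (e.symm j) ∩ S)
    (fun j => (measurableSet_atom hW _).inter hS)
    (fun i j hij => (disjoint_atom (e.symm.injective.ne hij)).mono Set.inter_subset_left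
      Set.inter_subset_left)
    (fun j => measure_ne_top_of_subset Set.inter_subset_right hfin)
    (g := fun x => g fun i => ∑ b : Set κ, if i ∈ b then x (e b) else 0)
    (hg.comp (measurable_pi_lambda _ fun i => Finset.measurable_sum _ fun b _ => by
      split_ifs <;> fun_prop))
    (fun x => hM _) (fun j => Set.inter_subset_right) ?_
  rw [hc]
  ext ξ
  congr 1
  ext i
  simpa [CountingMeasure.counts] using measure_inter_eq_sum_atom hW hS (ξ : Measure U) i

end IsPoissonProcess

/-- `D_u c` differs from `D_u f` by the values of `f - c` at `ξ + δ_u` and at `ξ`. Measuring the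
former under the pushforward of `Q` requires no relation between the law of `ξ + δ_u` and that of
`ξ`, so the Mecke formula is not needed. -/
theorem eLpNorm_diffOp_le {U : Type*} [MeasurableSpace U] {f c : CountingMeasure U → ℝ}
    (hf : Measurable f) (hc : Measurable c) (Q : Measure (CountingMeasure U × U)) :
    eLpNorm (fun z : CountingMeasure U × U => diffOp z.2 c z.1) 2 Q ≤
      eLpNorm (fun z : CountingMeasure U × U => diffOp z.2 f z.1) 2 Q +
        (eLpNorm (fun ξ => f ξ - c ξ) 2 (Q.map fun z => z.1.addPoint z.2) +
          eLpNorm (fun ξ => f ξ - c ξ) 2 (Q.map Prod.fst)) := by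
  have madd := CountingMeasure.measurable_addPoint (U := U)
  have mfc : Measurable fun ξ => f ξ - c ξ := hf.sub hc
  have mA := (mfc.comp madd).aestronglyMeasurable (μ := Q)
  have mB : AEStronglyMeasurable ((fun ξ => f ξ - c ξ) ∘ Prod.fst) Q :=
    (mfc.comp measurable_fst).aestronglyMeasurable
  have q1 := eLpNorm_sub_le (measurable_diffOp hf).aestronglyMeasurable (mA.sub mB)
    (μ := Q) (p := 2) (by norm_num)
  have q2 := eLpNorm_sub_le mA mB (p := 2) (by norm_num)
  rw [eLpNorm_map_measure mfc.aestronglyMeasurable madd.aemeasurable,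
    eLpNorm_map_measure mfc.aestronglyMeasurable measurable_fst.aemeasurable]
  refine le_trans (le_of_eq ?_) (q1.trans (add_le_add le_rfl q2))
  congr 1
  ext z
  simp only [diffOp, Pi.sub_apply, Function.comp]
  ring

namespace IsPoissonProcess

variable {U : Type*} [MeasurableSpace U] {μ : Measure U} {L : Measure (CountingMeasure U)}
  [IsProbabilityMeasure L]

theorem poincare_of_restrict [SigmaFinite μ] (h : IsPoissonProcess id μ L) {S : Set U}
    (hS : MeasurableSet S) (hfin : μ S ≠ ∞) {f : CountingMeasure U → ℝ} (hf : Measurable f)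
    {M : ℝ} (hM : ∀ ξ, |f ξ| ≤ M) (hres : ∀ ξ, f (ξ.restrict hS) = f ξ) :
    eLpNorm (fun ξ => f ξ - ∫ ζ, f ζ ∂L) 2 L ≤
      eLpNorm (fun z : CountingMeasure U × U => diffOp z.2 f z.1) 2 (L.prod (μ.restrict S)) := by
  have : IsFiniteMeasure (μ.restrict S) := ⟨by simpa using hfin.lt_top⟩
  set Q := L.prod (μ.restrict S) with hQ
  have mres := CountingMeasure.measurable_restrict hS
  -- A finite measure, because `μ S < ∞`, which dominates the laws of `ξ` and `ξ + δ_u`. One `L^2 ν`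
  -- approximation therefore controls both the variance and the difference operator.
  set ν := L + (Q.map (fun z => z.1.addPoint z.2) + Q.map Prod.fst) with hν
  refine ENNReal.le_of_forall_pos_le_add fun ε hε _ => ?_
  -- Four errors: two from the difference operator and two from the perturbation of the variance.
  have hε' : ((ε / 4 : ℝ≥0) : ℝ≥0∞) ≠ 0 := by
    have : 0 < ε / 4 := by positivity
    exact_mod_cast this.ne'
  -- Approximating under the law of the restricted configuration yields a function of counts in sets
  -- `W ∩ S`, and `hres` lets `f` be evaluated there.
  obtain ⟨c₀, hc₀, T, g, hg, ⟨K, hK⟩, rfl⟩ := exists_isCylinderFunction_eLpNorm_sub_le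
    (φ := fun (W : {W : Set U // MeasurableSet W}) (ξ : CountingMeasure U) => (ξ : Measure U) W)
    (fun W => CountingMeasure.measurable_eval W.2)
    (CountingMeasure.measurableSpace_le_iSup fun V hV =>
      Measurable.mono (comap_measurable _) (le_iSup (fun W : {W : Set U // MeasurableSet W} =>
        MeasurableSpace.comap (fun ξ : CountingMeasure U => (ξ : Measure U) W) inferInstance)
        ⟨V, hV⟩) le_rfl)
    (ν.map (CountingMeasure.restrict hS)) (memLp_of_forall_abs_le _ hf hM 2) hε'
  have hW : ∀ i : T, MeasurableSet ((i : {W : Set U // MeasurableSet W}) : Set U) :=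
    fun i => i.1.2
  set c : CountingMeasure U → ℝ := fun ξ => g (ξ.counts fun i : T => (i : Set U) ∩ S) with hc
  have hmc : Measurable c :=
    hg.comp (CountingMeasure.measurable_counts fun i => (hW i).inter hS)
  have hcK : ∀ ξ, |c ξ| ≤ K := fun ξ => hK _
  have hdiff : eLpNorm (fun ξ => f ξ - c ξ) 2 ν ≤ (ε / 4 : ℝ≥0) := by
    rw [eLpNorm_map_measure ?_ mres.aemeasurable] at hc₀
    · convert hc₀ using 2
      ext ξ
      simp only [Function.comp, Pi.sub_apply, hres, hc]
      congr 2
      ext i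
      exact (CountingMeasure.restrict_apply hS ξ (hW i)).symm
    · exact (hf.sub (hg.comp (CountingMeasure.measurable_counts hW))).aestronglyMeasurable
  have l1 : L ≤ ν := Measure.le_add_right le_rfl
  have l2 : Q.map (fun z => z.1.addPoint z.2) ≤ ν :=
    (Measure.le_add_right le_rfl : _ ≤ Q.map (fun z => z.1.addPoint z.2) + Q.map Prod.fst).trans
      (Measure.le_add_left le_rfl)
  have l3 : Q.map Prod.fst ≤ ν :=
    (Measure.le_add_left le_rfl : _ ≤ Q.map (fun z => z.1.addPoint z.2) + Q.map Prod.fst).trans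
      (Measure.le_add_left le_rfl)
  have d1 := (eLpNorm_mono_measure _ l1).trans hdiff
  have d2 := (eLpNorm_mono_measure _ l2).trans hdiff
  have d3 := (eLpNorm_mono_measure _ l3).trans hdiff
  have hp := h.poincare_of_eval_inter hW hS hfin hg hK hc
  have q3 := eLpNorm_sub_integral_le L (memLp_of_forall_abs_le _ hf hM 2)
    (memLp_of_forall_abs_le _ hmc hcK 2)
  refine q3.trans ((add_le_add (hp.trans ((eLpNorm_diffOp_le hf hmc Q).trans
    (add_le_add le_rfl (add_le_add d2 d3)))) (mul_le_mul_right d1 2)).trans (le_of_eq ?_))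
  rw [add_assoc]
  congr 1
  have : ε = ε / 4 + ε / 4 + 2 * (ε / 4) := NNReal.eq (by push_cast; ring)
  conv_rhs => rw [this]
  push_cast
  rfl

/-- The `L^2` Poincaré inequality. -/
theorem poincare [SigmaFinite μ] (h : IsPoissonProcess id μ L) {f : CountingMeasure U → ℝ}
    (hf : Measurable f) {M : ℝ} (hM : ∀ ξ, |f ξ| ≤ M) :
    eLpNorm (fun ξ => f ξ - ∫ ζ, f ζ ∂L) 2 L ≤
      eLpNorm (fun z : CountingMeasure U × U => diffOp z.2 f z.1) 2 (L.prod μ) := by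
  refine ENNReal.le_of_forall_pos_le_add fun ε hε _ => ?_
  have hε' : ((ε / 2 : ℝ≥0) : ℝ≥0∞) ≠ 0 := by
    have : 0 < ε / 2 := by positivity
    exact_mod_cast this.ne'
  have hSm : ∀ m, MeasurableSet (spanningSets μ m) := fun m => measurableSet_spanningSets μ m
  -- Only sets inside some spanning set are used as coordinates; they generate since `ξ V` is the
  -- supremum of `ξ (V ∩ spanningSets μ m)`. The finitely many coordinates of `c` then see a single
  -- set `S` of finite measure.
  obtain ⟨c, hc, T, g, hg, ⟨K, hK⟩, hcT⟩ := exists_isCylinderFunction_eLpNorm_sub_le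
    (φ := fun (W : {W : Set U // MeasurableSet W} × ℕ) (ξ : CountingMeasure U) =>
      (ξ : Measure U) (W.1 ∩ spanningSets μ W.2))
    (fun W => CountingMeasure.measurable_eval (W.1.2.inter (hSm W.2)))
    (CountingMeasure.measurableSpace_le_iSup fun V hV => by
      have : (fun ξ : CountingMeasure U => (ξ : Measure U) V) =
          fun ξ : CountingMeasure U => ⨆ m, (ξ : Measure U) (V ∩ spanningSets μ m) := by
        ext ξ
        rw [← Monotone.measure_iUnion, ← Set.inter_iUnion, iUnion_spanningSets, Set.inter_univ]
        exact fun i j hij => Set.inter_subset_inter_right _ (monotone_spanningSets μ hij)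
      rw [this]
      refine Measurable.iSup fun m => ?_
      exact Measurable.mono (comap_measurable _) (le_iSup
        (fun W : {W : Set U // MeasurableSet W} × ℕ => MeasurableSpace.comap
          (fun ξ : CountingMeasure U => (ξ : Measure U) (W.1 ∩ spanningSets μ W.2)) inferInstance)
        (⟨V, hV⟩, m)) le_rfl)
    L (memLp_of_forall_abs_le _ hf hM 2) hε'
  have hmc : Measurable c := by
    rw [hcT]
    exact hg.comp (measurable_pi_lambda _ fun i =>
      CountingMeasure.measurable_eval (i.1.1.2.inter (hSm i.1.2)))
  have hcK : ∀ ξ, |c ξ| ≤ K := fun ξ => by rw [hcT]; exact hK _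
  obtain ⟨m, hm⟩ : ∃ m, ∀ i ∈ T, i.2 ≤ m := ⟨T.sup Prod.snd, fun i hi => Finset.le_sup hi⟩
  set S := spanningSets μ m with hSdef
  have hS : MeasurableSet S := hSm m
  have hglue : ∀ ξ ζ, c (CountingMeasure.glue hS ξ ζ) = c ξ := fun ξ ζ => by
    rw [hcT]
    simp only
    congr 1
    ext i
    have hsub : spanningSets μ i.1.2 ⊆ S := monotone_spanningSets μ (hm i.1 i.2)
    rw [CountingMeasure.glue_apply hS _ _ (i.1.1.2.inter (hSm _)), Set.inter_assoc,
      Set.inter_eq_left.2 hsub, Set.inter_assoc,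
      (Set.disjoint_compl_right_iff_subset.2 hsub).inter_eq]
    simp
  have hmp : MeasurePreserving
      (fun z : CountingMeasure U × CountingMeasure U => CountingMeasure.glue hS z.1 z.2)
      (L.prod L) L := ⟨CountingMeasure.measurable_glue hS, h.map_glue hS⟩
  -- The conditional mean of `f` given the configuration `ζ` outside `S`. The deviation of `f` from
  -- its mean splits into `f - a`, treated by the finite case for each fixed `ζ`, and `a - E f`,
  -- which is at most `ε` in `L^2`.
  set a : CountingMeasure U → ℝ := fun ζ => ∫ ξ, f (CountingMeasure.glue hS ξ ζ) ∂L with ha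
  have hfg : Measurable fun z : CountingMeasure U × CountingMeasure U =>
    f (CountingMeasure.glue hS z.1 z.2) := hf.comp hmp.measurable
  have hma : Measurable a := hfg.stronglyMeasurable.integral_prod_left.measurable
  have hm1 : Measurable fun z : CountingMeasure U × CountingMeasure U =>
      f (CountingMeasure.glue hS z.1 z.2) - a z.2 := hfg.sub (hma.comp measurable_snd)
  have n1 : eLpNorm (fun z : CountingMeasure U × CountingMeasure U =>
      f (CountingMeasure.glue hS z.1 z.2) - a z.2) 2 (L.prod L) ≤
      eLpNorm (fun z : CountingMeasure U × U => diffOp z.2 f z.1) 2 (L.prod μ) := by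
    refine eLpNorm_two_le_of_lintegral_le ?_
    have hmd : ∀ u, Measurable fun ξ => ‖diffOp u f ξ‖ₑ ^ 2 := fun u =>
      ((measurable_diffOp hf).comp (measurable_id.prodMk measurable_const)).enorm.pow_const 2
    rw [lintegral_prod_symm _ (hm1.enorm.pow_const 2).aemeasurable,
      lintegral_prod_symm _ ((measurable_diffOp hf).enorm.pow_const 2).aemeasurable]
    calc ∫⁻ ζ, ∫⁻ ξ, ‖f (CountingMeasure.glue hS ξ ζ) - a ζ‖ₑ ^ 2 ∂L ∂L
        ≤ ∫⁻ ζ, ∫⁻ u in S, ∫⁻ ξ, ‖diffOp u f (CountingMeasure.glue hS ξ ζ)‖ₑ ^ 2 ∂L ∂μ ∂L := by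
          refine lintegral_mono fun ζ => ?_
          have hfζ : Measurable fun ξ => f (CountingMeasure.glue hS ξ ζ) :=
            hfg.comp (measurable_id.prodMk measurable_const)
          have hp := h.poincare_of_restrict hS (measure_spanningSets_lt_top μ m).ne hfζ
            (fun ξ => hM _) fun ξ => by rw [CountingMeasure.glue_restrict]
          have hp2 := pow_le_pow_left' hp 2
          rw [eLpNorm_two_pow_two, eLpNorm_two_pow_two,
            lintegral_prod_symm _ ((measurable_diffOp hfζ).enorm.pow_const 2).aemeasurable] at hp2
          refine hp2.trans (le_of_eq (setLIntegral_congr_fun hS fun u hu => ?_))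
          simp only [diffOp, CountingMeasure.glue_addPoint hS _ _ hu]
      _ = ∫⁻ u in S, ∫⁻ ζ, ∫⁻ ξ, ‖diffOp u f (CountingMeasure.glue hS ξ ζ)‖ₑ ^ 2 ∂L ∂L ∂μ := by
          refine lintegral_lintegral_swap (Measurable.aemeasurable ?_)
          have : Measurable fun w : (CountingMeasure U × U) × CountingMeasure U =>
              ‖diffOp w.1.2 f (CountingMeasure.glue hS w.2 w.1.1)‖ₑ ^ 2 :=
            ((measurable_diffOp hf).comp ((hmp.measurable.comp (measurable_snd.prodMk
              (measurable_fst.comp measurable_fst))).prodMk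
                (measurable_snd.comp measurable_fst))).enorm.pow_const 2
          exact this.lintegral_prod_right'
      _ = ∫⁻ u in S, ∫⁻ ξ, ‖diffOp u f ξ‖ₑ ^ 2 ∂L ∂μ := by
          refine lintegral_congr fun u => ?_
          rw [← hmp.lintegral_comp (hmd u)]
          exact (lintegral_prod_symm _ ((hmd u).comp hmp.measurable).aemeasurable).symm
      _ ≤ ∫⁻ u, ∫⁻ ξ, ‖diffOp u f ξ‖ₑ ^ 2 ∂L ∂μ := setLIntegral_le_lintegral _ _
  have mfc : Measurable fun ξ => f ξ - c ξ := hf.sub hmc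
  -- As `c` ignores `ζ`, `a ζ - E c` is the average over `ξ` of `f - c` at the glued configuration,
  -- and averaging contracts `L^2`.
  have n2 : eLpNorm (fun ζ => a ζ - ∫ ξ, c ξ ∂L) 2 L ≤ eLpNorm (f - c) 2 L := by
    refine eLpNorm_two_le_of_lintegral_le ?_
    have hm2 : Measurable fun ξ => ‖(f - c) ξ‖ₑ ^ 2 := mfc.enorm.pow_const 2
    rw [← hmp.lintegral_comp hm2]
    refine le_trans (lintegral_mono fun ζ => ?_)
      (lintegral_prod_symm _ (hm2.comp hmp.measurable).aemeasurable).ge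
    have hfζ : Measurable fun ξ => f (CountingMeasure.glue hS ξ ζ) :=
      hfg.comp (measurable_id.prodMk measurable_const)
    have e : a ζ - ∫ ξ, c ξ ∂L = ∫ ξ, (f (CountingMeasure.glue hS ξ ζ) - c ξ) ∂L :=
      (integral_sub (integrable_of_forall_abs_le L hfζ fun ξ => hM _)
        (integrable_of_forall_abs_le L hmc hcK)).symm
    have hle := pow_le_pow_left'
      (enorm_integral_le_eLpNorm_two L (hfζ.sub hmc).aestronglyMeasurable) 2
    rw [eLpNorm_two_pow_two] at hle
    simp only [Pi.sub_apply, Function.comp, hglue, e]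
    exact hle
  have n3 : ‖∫ ξ, c ξ ∂L - ∫ ξ, f ξ ∂L‖ₑ ≤ eLpNorm (f - c) 2 L := by
    rw [enorm_sub_rev, ← integral_sub (integrable_of_forall_abs_le L hf hM)
      (integrable_of_forall_abs_le L hmc hcK)]
    exact enorm_integral_le_eLpNorm_two L mfc.aestronglyMeasurable
  have n4 : eLpNorm (fun z : CountingMeasure U × CountingMeasure U => a z.2 - ∫ ξ, f ξ ∂L) 2
      (L.prod L) ≤ ε := by
    have e1 := eLpNorm_comp_measurePreserving (p := 2)
      (hma.sub measurable_const (g := fun _ => ∫ ξ, f ξ ∂L)).aestronglyMeasurable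
      (measurePreserving_snd (μ := L) (ν := L))
    refine e1.le.trans ?_
    have e2 : (a - fun _ => ∫ ξ, f ξ ∂L) = (fun ζ => a ζ - ∫ ξ, c ξ ∂L) +
        fun _ => ∫ ξ, c ξ ∂L - ∫ ξ, f ξ ∂L := by
      ext ζ
      simp only [Pi.add_apply, Pi.sub_apply]
      ring
    rw [e2]
    refine (eLpNorm_add_le (hma.sub measurable_const).aestronglyMeasurable
      aestronglyMeasurable_const (by norm_num)).trans ?_
    rw [eLpNorm_const_two]
    refine (add_le_add (n2.trans hc) (n3.trans hc)).trans (le_of_eq ?_)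
    rw [← ENNReal.coe_add, add_halves]
  have e1 := eLpNorm_comp_measurePreserving (p := 2)
      (hf.sub measurable_const (g := fun _ => ∫ ξ, f ξ ∂L)).aestronglyMeasurable hmp
  refine (le_of_eq e1.symm).trans ?_
  have e2 : (f - fun _ => ∫ ξ, f ξ ∂L) ∘ (fun z : CountingMeasure U × CountingMeasure U =>
      CountingMeasure.glue hS z.1 z.2) =
      (fun z => f (CountingMeasure.glue hS z.1 z.2) - a z.2) +
        fun z => a z.2 - ∫ ξ, f ξ ∂L := by
    ext z
    simp only [Pi.add_apply, Pi.sub_apply, Function.comp]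
    ring
  rw [e2]
  exact (eLpNorm_add_le hm1.aestronglyMeasurable
    ((hma.comp measurable_snd).sub measurable_const).aestronglyMeasurable (by norm_num)).trans
    (add_le_add n1 n4)

end IsPoissonProcess

/-! ### Elementary inequalities -/

/-- Bernoulli's inequality for `(t / s) ^ q`, multiplied by `s ^ q`. -/
theorem rpow_sub_rpow_le {q s t : ℝ} (hq : 1 ≤ q) (ht : 0 ≤ t) (hts : t ≤ s) :
    s ^ q - t ^ q ≤ q * (s - t) * s ^ (q - 1) := by
  rcases (ht.trans hts).eq_or_lt with hs | hs
  · have : t = 0 := le_antisymm (hts.trans hs.ge) ht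
    simp [← hs, this]
  have hb := one_add_mul_self_le_rpow_one_add (s := t / s - 1) (by
    have : 0 ≤ t / s := by positivity
    linarith) hq
  have e : (1 + (t / s - 1)) ^ q * s ^ q = t ^ q := by
    rw [← Real.mul_rpow (by simpa using (by positivity : 0 ≤ t / s)) hs.le]
    congr 1
    field_simp
    ring
  have e2 : s ^ q = s ^ (q - 1) * s := by
    rw [← Real.rpow_add_one hs.ne', sub_add_cancel]
  have h3 := mul_le_mul_of_nonneg_right hb (Real.rpow_nonneg hs.le q)
  rw [e] at h3
  have e3 : (1 + q * (t / s - 1)) * s ^ q = s ^ q - q * (s - t) * s ^ (q - 1) := by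
    rw [e2]
    field_simp
    ring
  linarith

/-- The larger of `|a|` and `|b|` is at most `2 * max |b| d`. Here `a` will be the value at `ξ +
δ_u`; the bound must involve only the value `b` at `ξ`, whose moments are those of `f`. -/
theorem abs_abs_rpow_sub_le {q a b d : ℝ} (hq : 1 ≤ q) (hd : |a - b| ≤ d) :
    |(|a| ^ q - |b| ^ q)| ≤ q * 2 ^ (q - 1) * (|b| ^ (q - 1) * d + d ^ q) := by
  have hd0 : 0 ≤ d := (abs_nonneg _).trans hd
  have hq0 : 0 ≤ q - 1 := by linarith
  have hdq : d ^ q = d ^ (q - 1) * d := by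
    rcases hd0.eq_or_lt with h | h
    · rw [← h, Real.zero_rpow (by linarith), mul_zero]
    · rw [← Real.rpow_add_one h.ne', sub_add_cancel]
  have h2 : (1 : ℝ) ≤ 2 ^ (q - 1) := Real.one_le_rpow (by norm_num) hq0
  have hab := (abs_abs_sub_abs_le a b).trans hd
  have hB := Real.rpow_nonneg (abs_nonneg b) (q - 1)
  have hD := Real.rpow_nonneg hd0 (q - 1)
  rw [hdq, ← add_mul]
  rcases le_total |b| |a| with h | h
  · rw [abs_of_nonneg (sub_nonneg.2 (Real.rpow_le_rpow (abs_nonneg _) h (by linarith)))]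
    refine (rpow_sub_rpow_le hq (abs_nonneg b) h).trans ?_
    have h1 : |a| - |b| ≤ d := (le_abs_self _).trans hab
    have h3 : |a| ^ (q - 1) ≤ 2 ^ (q - 1) * (|b| ^ (q - 1) + d ^ (q - 1)) := by
      rcases le_total |b| d with hbd | hbd
      · refine (Real.rpow_le_rpow (abs_nonneg a) (show |a| ≤ 2 * d by linarith) hq0).trans ?_
        rw [Real.mul_rpow (by norm_num) hd0]
        exact mul_le_mul_of_nonneg_left (by linarith) (by positivity)
      · refine (Real.rpow_le_rpow (abs_nonneg a) (show |a| ≤ 2 * |b| by linarith) hq0).trans ?_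
        rw [Real.mul_rpow (by norm_num) (abs_nonneg b)]
        exact mul_le_mul_of_nonneg_left (by linarith) (by positivity)
    calc q * (|a| - |b|) * |a| ^ (q - 1)
        ≤ q * d * (2 ^ (q - 1) * (|b| ^ (q - 1) + d ^ (q - 1))) := by gcongr
      _ = _ := by ring
  · rw [abs_sub_comm, abs_of_nonneg (sub_nonneg.2 (Real.rpow_le_rpow (abs_nonneg _) h
      (by linarith)))]
    refine (rpow_sub_rpow_le hq (abs_nonneg a) h).trans ?_
    have h1 : |b| - |a| ≤ d := (le_abs_self _).trans ((abs_sub_comm _ _).le.trans hab)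
    calc q * (|b| - |a|) * |b| ^ (q - 1)
        ≤ q * d * (2 ^ (q - 1) * (|b| ^ (q - 1) + d ^ (q - 1))) := by
          gcongr
          nlinarith
      _ = _ := by ring

/-- The constant in the chain rule for `x ↦ |x| ^ (p / 2)`. -/
noncomputable def chainConst (p : ℝ) : ℝ := 2 * (p / 2 * 2 ^ (p / 2 - 1)) ^ 2

theorem chainConst_nonneg (p : ℝ) : 0 ≤ chainConst p := by
  rw [chainConst]; positivity

/-- The preceding estimate with `q = p / 2`, squared; the leading `2` in `chainConst` comes from `(x
+ y) ^ 2 ≤ 2 x ^ 2 + 2 y ^ 2`. -/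
theorem sq_abs_rpow_sub_le {p a b d : ℝ} (hp : 2 ≤ p) (hd : |a - b| ≤ d) :
    (|a| ^ (p / 2) - |b| ^ (p / 2)) ^ 2 ≤ chainConst p * (|b| ^ (p - 2) * d ^ 2 + d ^ p) := by
  have hd0 : 0 ≤ d := (abs_nonneg _).trans hd
  have h := abs_abs_rpow_sub_le (q := p / 2) (by linarith) hd
  have e1 : |b| ^ (p - 2) = (|b| ^ (p / 2 - 1)) ^ 2 := by
    rw [← Real.rpow_natCast, ← Real.rpow_mul (abs_nonneg b)]
    congr 1; push_cast; ring
  have e2 : d ^ p = (d ^ (p / 2)) ^ 2 := by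
    rw [← Real.rpow_natCast, ← Real.rpow_mul hd0]
    congr 1; push_cast; ring
  rw [← sq_abs, e1, e2, chainConst]
  refine (pow_le_pow_left₀ (abs_nonneg _) h 2).trans ?_
  rw [mul_pow, mul_comm 2, mul_assoc]
  refine mul_le_mul_of_nonneg_left ?_ (sq_nonneg _)
  nlinarith [sq_nonneg (|b| ^ (p / 2 - 1) * d - d ^ (p / 2))]

theorem enorm_rpow_eq_ofReal (x : ℝ) {s : ℝ} (hs : 0 ≤ s) :
    ‖x‖ₑ ^ s = ENNReal.ofReal (|x| ^ s) := by
  rw [Real.enorm_eq_ofReal_abs, ENNReal.ofReal_rpow_of_nonneg (abs_nonneg x) hs]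

theorem enorm_sq_abs_rpow_sub_le {p a b d : ℝ} (hp : 2 ≤ p) (hd : |a - b| ≤ |d|) :
    ‖|a| ^ (p / 2) - |b| ^ (p / 2)‖ₑ ^ 2 ≤
      ENNReal.ofReal (chainConst p) * (‖b‖ₑ ^ (p - 2) * ‖d‖ₑ ^ 2 + ‖d‖ₑ ^ p) := by
  rw [enorm_sq_eq_ofReal, enorm_sq_eq_ofReal, enorm_rpow_eq_ofReal _ (by linarith),
    enorm_rpow_eq_ofReal _ (by linarith), ← ENNReal.ofReal_mul (by positivity),
    ← ENNReal.ofReal_add (by positivity) (by positivity),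
    ← ENNReal.ofReal_mul (chainConst_nonneg p), ← sq_abs d]
  exact ENNReal.ofReal_le_ofReal (sq_abs_rpow_sub_le hp hd)

theorem ENNReal.add_sq_le_two_mul (a b : ℝ≥0∞) : (a + b) ^ 2 ≤ 2 * a ^ 2 + 2 * b ^ 2 := by
  have h := ENNReal.rpow_add_le_mul_rpow_add_rpow a b (p := 2) (by norm_num)
  rw [show (2 : ℝ) - 1 = 1 by norm_num, ENNReal.rpow_one, mul_add] at h
  exact_mod_cast h

/-- Hölder's inequality with the exponents `p / (p - 2)` and `p / 2`. -/
theorem lintegral_rpow_sub_two_mul_sq_le {X : Type*} [MeasurableSpace X] (ν : Measure X)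
    {p : ℝ} (hp : 2 ≤ p) {a b : X → ℝ≥0∞} (ha : AEMeasurable a ν) (hb : AEMeasurable b ν) :
    ∫⁻ x, a x ^ (p - 2) * b x ^ 2 ∂ν ≤
      (∫⁻ x, a x ^ p ∂ν) ^ ((p - 2) / p) * (∫⁻ x, b x ^ p ∂ν) ^ (2 / p) := by
  have hp0 : 0 < p := by linarith
  have h := ENNReal.lintegral_mul_norm_pow_le (ha.pow_const p) (hb.pow_const p)
    (p := (p - 2) / p) (q := 2 / p) (by have : 0 ≤ p - 2 := by linarith
                                        positivity) (by positivity) (by field_simp; ring)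
  refine le_trans (le_of_eq ?_) h
  refine lintegral_congr fun x => ?_
  rw [← ENNReal.rpow_mul, ← ENNReal.rpow_mul, mul_div_cancel₀ _ hp0.ne', mul_div_cancel₀ _ hp0.ne']
  norm_cast

/-- A function whose `L^1` norm is small compared with `K` has an `L^q` norm which is controlled
by `K` and a small multiple of its `L^{2q}` norm. -/
theorem sq_lintegral_rpow_le {X : Type*} [MeasurableSpace X] (ν : Measure X)
    [IsProbabilityMeasure ν] {p : ℝ} (hp : 2 ≤ p) {w : X → ℝ≥0∞} (hw : Measurable w) {K : ℝ≥0∞}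
    (hK0 : K ≠ 0) (hK : K ≠ ∞) :
    (∫⁻ x, w x ^ (p / 2) ∂ν) ^ 2 ≤
      2 * K ^ p + 2 * ((∫⁻ x, w x ∂ν) / K * ∫⁻ x, w x ^ p ∂ν) := by
  have hp0 : 0 < p := by linarith
  set A : Set X := {x | K ≤ w x} with hA
  have mA : MeasurableSet A := measurableSet_le measurable_const hw
  -- Below level `K` the integrand is at most `K ^ (p / 2)`. Above it, Cauchy–Schwarz against the
  -- indicator of `A` produces `ν A`, bounded by Markov's inequality.
  have h1 : ∫⁻ x, w x ^ (p / 2) ∂ν ≤ K ^ (p / 2) +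
      ∫⁻ x, (A.indicator 1 x) ^ (1 / 2 : ℝ) * (w x ^ p) ^ (1 / 2 : ℝ) ∂ν := by
    calc ∫⁻ x, w x ^ (p / 2) ∂ν
        ≤ ∫⁻ x, (K ^ (p / 2) + (A.indicator 1 x) ^ (1 / 2 : ℝ) * (w x ^ p) ^ (1 / 2 : ℝ)) ∂ν := by
          refine lintegral_mono fun x => ?_
          by_cases hx : x ∈ A
          · refine le_add_left (le_of_eq ?_)
            rw [Set.indicator_of_mem hx, Pi.one_apply, ENNReal.one_rpow, one_mul,
              ← ENNReal.rpow_mul, mul_one_div]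
          · refine le_add_right (ENNReal.rpow_le_rpow (le_of_not_ge hx) (by positivity))
      _ = _ := by rw [lintegral_add_left measurable_const]; simp
  have h2 := ENNReal.lintegral_mul_norm_pow_le (μ := ν) (f := A.indicator 1) (g := fun x => w x ^ p)
    (p := 1 / 2) (q := 1 / 2) (measurable_one.indicator mA).aemeasurable
    (hw.pow_const p).aemeasurable (by norm_num) (by norm_num) (by norm_num)
  rw [lintegral_indicator_one mA, ← ENNReal.mul_rpow_of_nonneg _ _ (by norm_num)] at h2
  have h3 := pow_le_pow_left' (h1.trans (add_le_add le_rfl h2)) 2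
  refine (h3.trans (ENNReal.add_sq_le_two_mul _ _)).trans ?_
  have e : ∀ (y : ℝ≥0∞) (s : ℝ), (y ^ (s / 2)) ^ 2 = y ^ s := fun y s => by
    rw [← ENNReal.rpow_natCast, ← ENNReal.rpow_mul]
    congr 1; push_cast; ring
  rw [e, e, ENNReal.rpow_one]
  gcongr
  exact meas_ge_le_lintegral_div hw.aemeasurable hK0 hK

/-- If `x > l R` with `l = 64 + 4 c`, then `r = x / l` is admissible, even when `R = 0`. Dividing by
`x ^ p` and using `p ≥ 2`, the right side is at most `1 / 4 + (1024 + 4 c) / l ^ 2 ≤ 3 / 4`, a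
contradiction. -/
theorem le_mul_of_forall_rpow_le {p c x R : ℝ} (hp : 2 ≤ p) (hc : 0 ≤ c) (hx : 0 ≤ x)
    (hR : 0 ≤ R)
    (h : ∀ r, 0 < r → R ≤ r → x ^ p ≤ 4 * (16 * r) ^ p + x ^ p / 4 +
      2 * c * (x ^ (p - 2) * r ^ 2 + r ^ p)) : x ≤ (64 + 4 * c) * R := by
  by_contra! hlt
  set l := 64 + 4 * c with hl
  have hl0 : 64 ≤ l := by linarith
  have hx0 : 0 < x := lt_of_le_of_lt (by positivity) hlt
  have hxp : 0 < x ^ p := Real.rpow_pos_of_pos hx0 p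
  have hr := h (x / l) (by positivity) ((le_div_iff₀ (by linarith)).2 (by linarith))
  have hsq : ∀ y : ℝ, 0 ≤ y → y ≤ 1 → y ^ p ≤ y ^ 2 := fun y h0 h1 => by
    rw [← Real.rpow_natCast]
    rcases h0.eq_or_lt with h | h
    · rw [← h, Real.zero_rpow (by linarith), Real.zero_rpow (by norm_num)]
    · exact Real.rpow_le_rpow_of_exponent_ge h h1 (by exact_mod_cast hp)
  have e1 : (16 * (x / l)) ^ p = x ^ p * (16 / l) ^ p := by
    rw [← Real.mul_rpow hx (by positivity)]; congr 1; ring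
  have e2 : (x / l) ^ p = x ^ p * (1 / l) ^ p := by
    rw [← Real.mul_rpow hx (by positivity)]; congr 1; ring
  have e3 : x ^ (p - 2) * (x / l) ^ 2 = x ^ p * (1 / l) ^ 2 := by
    have : x ^ p = x ^ (p - 2) * x ^ 2 := by
      rw [← Real.rpow_natCast, ← Real.rpow_add hx0]; congr 1; push_cast; ring
    rw [this]; ring
  have b1 := hsq (16 / l) (by positivity) ((div_le_one (by linarith)).2 (by linarith))
  have b2 := hsq (1 / l) (by positivity) ((div_le_one (by linarith)).2 (by linarith))
  rw [e1, e2, e3] at hr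
  have b3 : 4 * (16 / l) ^ p + 1 / 4 + 2 * c * ((1 / l) ^ 2 + (1 / l) ^ p) ≤ 3 / 4 := by
    have : 4 * (16 / l) ^ 2 + 2 * c * ((1 / l) ^ 2 + (1 / l) ^ 2) ≤ 1 / 2 := by
      rw [show 4 * (16 / l) ^ 2 + 2 * c * ((1 / l) ^ 2 + (1 / l) ^ 2) =
        (1024 + 4 * c) / l ^ 2 by field_simp; ring, div_le_iff₀ (by positivity), hl]
      nlinarith
    have h4 : 2 * c * ((1 / l) ^ 2 + (1 / l) ^ p) ≤ 2 * c * ((1 / l) ^ 2 + (1 / l) ^ 2) := by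
      gcongr
    linarith
  nlinarith

/-! ### The `L^p` Poincaré inequality for bounded functionals -/

/-- `M` bounds `G` in a norm which is strong enough for the `L^p` Poincaré inequality. -/
structure IsControl {X U : Type*} [MeasurableSpace X] [MeasurableSpace U] (p : ℝ) (L : Measure X)
    (μ : Measure U) (G : X → U → ℝ) (M : ℝ≥0∞) : Prop where
  weighted : ∀ w : X → ℝ≥0∞, Measurable w →
    ∫⁻ ξ, w ξ ^ (p - 2) * ∫⁻ u, ‖G ξ u‖ₑ ^ 2 ∂μ ∂L ≤ (∫⁻ ξ, w ξ ^ p ∂L) ^ ((p - 2) / p) * M ^ 2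
  power : ∫⁻ ξ, ∫⁻ u, ‖G ξ u‖ₑ ^ p ∂μ ∂L ≤ M ^ p

theorem IsControl.lintegral_sq_le {X U : Type*} [MeasurableSpace X] [MeasurableSpace U] {p : ℝ}
    {L : Measure X} [IsProbabilityMeasure L] {μ : Measure U} {G : X → U → ℝ} {M : ℝ≥0∞}
    (h : IsControl p L μ G M) : ∫⁻ ξ, ∫⁻ u, ‖G ξ u‖ₑ ^ 2 ∂μ ∂L ≤ M ^ 2 := by
  simpa using h.weighted (fun _ => 1) measurable_const

/-- The constant in the `L^p` Poincaré inequality. -/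
noncomputable def poincareConst (p : ℝ) : ℝ≥0 :=
  ⟨64 + 4 * chainConst p, by have := chainConst_nonneg p; linarith⟩

namespace IsPoissonProcess

variable {U : Type*} [MeasurableSpace U] {μ : Measure U} {L : Measure (CountingMeasure U)}
  [IsProbabilityMeasure L]

/-- The `L^1` norm is at most the `L^2` norm, hence at most the mean plus the standard deviation.
`G` only dominates `Df`, so that truncations of a functional can share its control. -/
theorem lintegral_enorm_le_of_isControl [SigmaFinite μ] (h : IsPoissonProcess id μ L) {p : ℝ}
    {f : CountingMeasure U → ℝ} (hf : Measurable f) {B : ℝ} (hB : ∀ ξ, |f ξ| ≤ B)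
    {G : CountingMeasure U → U → ℝ} {M : ℝ≥0∞} (hG : IsControl p L μ G M)
    (hfG : ∀ ξ u, |diffOp u f ξ| ≤ |G ξ u|) :
    ∫⁻ ξ, ‖f ξ‖ₑ ∂L ≤ ‖∫ ξ, f ξ ∂L‖ₑ + M := by
  have h1 := h.poincare hf hB
  have h2 : eLpNorm (fun z : CountingMeasure U × U => diffOp z.2 f z.1) 2 (L.prod μ) ≤ M := by
    refine (ENNReal.pow_le_pow_left_iff (n := 2) (by norm_num)).1 ?_
    rw [eLpNorm_two_pow_two,
      lintegral_prod _ ((measurable_diffOp hf).enorm.pow_const 2).aemeasurable]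
    refine le_trans (lintegral_mono fun ξ => lintegral_mono fun u => ?_) hG.lintegral_sq_le
    refine pow_le_pow_left' ?_ 2
    rw [Real.enorm_eq_ofReal_abs, Real.enorm_eq_ofReal_abs]
    exact ENNReal.ofReal_le_ofReal (hfG ξ u)
  rw [← eLpNorm_one_eq_lintegral_enorm]
  have m1 : AEStronglyMeasurable (fun ξ => f ξ - ∫ ζ, f ζ ∂L) L :=
    (hf.sub measurable_const).aestronglyMeasurable
  have h3 := eLpNorm_add_le m1 (aestronglyMeasurable_const (b := ∫ ζ, f ζ ∂L)) (p := 2)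
    (by norm_num)
  rw [eLpNorm_const_two] at h3
  refine (eLpNorm_le_eLpNorm_of_exponent_le (q := 2) (by norm_num)
    hf.aestronglyMeasurable).trans ?_
  have e : f = (fun ξ => f ξ - ∫ ζ, f ζ ∂L) + fun _ => ∫ ζ, f ζ ∂L := by
    ext ξ; simp
  rw [← e] at h3
  refine h3.trans ?_
  rw [add_comm]
  exact add_le_add le_rfl (h1.trans h2)

/-- The `L^2` inequality for `|f| ^ (p / 2)`: its mean is cut at level `K`, and its energy is
bounded by the chain rule and by `IsControl.weighted` with weight `|f|`. -/
theorem lintegral_enorm_rpow_le_of_isControl [SigmaFinite μ] (h : IsPoissonProcess id μ L) {p : ℝ}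
    (hp : 2 ≤ p) {f : CountingMeasure U → ℝ} (hf : Measurable f) {B : ℝ} (hB : ∀ ξ, |f ξ| ≤ B)
    {G : CountingMeasure U → U → ℝ} (hGm : Measurable (Function.uncurry G)) {M : ℝ≥0∞}
    (hG : IsControl p L μ G M) (hfG : ∀ ξ u, |diffOp u f ξ| ≤ |G ξ u|) {K : ℝ≥0∞}
    (hK0 : K ≠ 0) (hK : K ≠ ∞) :
    ∫⁻ ξ, ‖f ξ‖ₑ ^ p ∂L ≤ 4 * K ^ p +
      4 * ((∫⁻ ξ, ‖f ξ‖ₑ ∂L) / K * ∫⁻ ξ, ‖f ξ‖ₑ ^ p ∂L) +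
      2 * (ENNReal.ofReal (chainConst p) *
        ((∫⁻ ξ, ‖f ξ‖ₑ ^ p ∂L) ^ ((p - 2) / p) * M ^ 2 + M ^ p)) := by
  have hp2 : 0 ≤ p / 2 := by linarith
  set k : CountingMeasure U → ℝ := fun ξ => |f ξ| ^ (p / 2) with hk
  have mk : Measurable k := (measurable_abs.comp hf).pow_const _
  have hk0 : ∀ ξ, 0 ≤ k ξ := fun ξ => Real.rpow_nonneg (abs_nonneg _) _
  have hkB : ∀ ξ, |k ξ| ≤ B ^ (p / 2) := fun ξ => by
    rw [abs_of_nonneg (hk0 ξ)]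
    exact Real.rpow_le_rpow (abs_nonneg _) (hB ξ) hp2
  have ek : ∀ ξ, ‖k ξ‖ₑ = ‖f ξ‖ₑ ^ (p / 2) := fun ξ => by
    rw [enorm_rpow_eq_ofReal _ hp2, Real.enorm_eq_ofReal (hk0 ξ)]
  have ek2 : eLpNorm k 2 L ^ 2 = ∫⁻ ξ, ‖f ξ‖ₑ ^ p ∂L := by
    rw [eLpNorm_two_pow_two]
    refine lintegral_congr fun ξ => ?_
    rw [ek, ← ENNReal.rpow_natCast, ← ENNReal.rpow_mul]
    congr 1; push_cast; ring
  have hD : eLpNorm (fun z : CountingMeasure U × U => diffOp z.2 k z.1) 2 (L.prod μ) ^ 2 ≤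
      ENNReal.ofReal (chainConst p) *
        ((∫⁻ ξ, ‖f ξ‖ₑ ^ p ∂L) ^ ((p - 2) / p) * M ^ 2 + M ^ p) := by
    rw [eLpNorm_two_pow_two,
      lintegral_prod _ ((measurable_diffOp mk).enorm.pow_const 2).aemeasurable]
    have hGξ : ∀ ξ, Measurable (G ξ) := fun ξ => hGm.comp measurable_prodMk_left
    calc ∫⁻ ξ, ∫⁻ u, ‖diffOp u k ξ‖ₑ ^ 2 ∂μ ∂L
        ≤ ∫⁻ ξ, ∫⁻ u, ENNReal.ofReal (chainConst p) *
            (‖f ξ‖ₑ ^ (p - 2) * ‖G ξ u‖ₑ ^ 2 + ‖G ξ u‖ₑ ^ p) ∂μ ∂L :=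
          lintegral_mono fun ξ => lintegral_mono fun u => enorm_sq_abs_rpow_sub_le hp (hfG ξ u)
      _ = ENNReal.ofReal (chainConst p) * (∫⁻ ξ, ‖f ξ‖ₑ ^ (p - 2) * ∫⁻ u, ‖G ξ u‖ₑ ^ 2 ∂μ ∂L +
            ∫⁻ ξ, ∫⁻ u, ‖G ξ u‖ₑ ^ p ∂μ ∂L) := by
          rw [← lintegral_add_left, ← lintegral_const_mul' _ _ ENNReal.ofReal_ne_top]
          · refine lintegral_congr fun ξ => ?_
            rw [lintegral_const_mul' _ _ ENNReal.ofReal_ne_top, lintegral_add_left,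
              lintegral_const_mul]
            · exact (hGξ ξ).enorm.pow_const 2
            · exact ((hGξ ξ).enorm.pow_const 2).const_mul _
          · exact (hf.enorm.pow_const _).mul
              (Measurable.lintegral_prod_right' (f := fun z => ‖Function.uncurry G z‖ₑ ^ 2)
                (hGm.enorm.pow_const 2))
      _ ≤ _ := by
          gcongr
          · exact hG.weighted _ hf.enorm
          · exact hG.power
  have h1 := h.poincare mk hkB
  have m1 : AEStronglyMeasurable (fun ξ => k ξ - ∫ ζ, k ζ ∂L) L :=
    (mk.sub measurable_const).aestronglyMeasurable
  have h3 := eLpNorm_add_le (aestronglyMeasurable_const (b := ∫ ζ, k ζ ∂L)) m1 (p := 2)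
    (by norm_num)
  have e : k = (fun _ => ∫ ζ, k ζ ∂L) + fun ξ => k ξ - ∫ ζ, k ζ ∂L := by
    ext ξ; simp
  rw [← e, eLpNorm_const_two] at h3
  have h4 : ‖∫ ζ, k ζ ∂L‖ₑ ≤ ∫⁻ ξ, ‖f ξ‖ₑ ^ (p / 2) ∂L := by
    refine (enorm_integral_le_lintegral_enorm k).trans (le_of_eq ?_)
    exact lintegral_congr ek
  have h5 := pow_le_pow_left' (h3.trans (add_le_add h4 h1)) 2
  rw [ek2] at h5
  refine (h5.trans (ENNReal.add_sq_le_two_mul _ _)).trans ?_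
  refine (add_le_add (mul_le_mul_right (sq_lintegral_rpow_le L hp hf.enorm hK0 hK) 2)
    (mul_le_mul_right hD 2)).trans (le_of_eq ?_)
  ring


/-- Boundedness makes the `p`-th moment finite, so that a quarter of it can be absorbed; the bound
`B` does not enter the constant. -/
theorem lintegral_rpow_le_of_bounded [SigmaFinite μ] (h : IsPoissonProcess id μ L) {p : ℝ}
    (hp : 2 ≤ p) {f : CountingMeasure U → ℝ} (hf : Measurable f) {B : ℝ} (hB : ∀ ξ, |f ξ| ≤ B)
    {G : CountingMeasure U → U → ℝ} (hGm : Measurable (Function.uncurry G)) {M : ℝ≥0∞}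
    (hG : IsControl p L μ G M) (hfG : ∀ ξ u, |diffOp u f ξ| ≤ |G ξ u|) :
    (∫⁻ ξ, ‖f ξ‖ₑ ^ p ∂L) ^ (1 / p) ≤ poincareConst p * (‖∫ ξ, f ξ ∂L‖ₑ + M) := by
  have hp0 : 0 < p := by linarith
  have hc := chainConst_nonneg p
  rcases eq_or_ne M ∞ with hM | hM
  -- Since `0 * ∞ = 0`, an infinite right side requires a nonzero constant.
  · have : (poincareConst p : ℝ≥0∞) ≠ 0 := by
      have : 0 < poincareConst p := show (0 : ℝ) < 64 + 4 * chainConst p by linarith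
      exact_mod_cast this.ne'
    rw [hM, add_top, ENNReal.mul_top this]
    exact le_top
  set X := ∫⁻ ξ, ‖f ξ‖ₑ ^ p ∂L with hX
  have hXfin : X ≠ ∞ := by
    have : X ≤ ∫⁻ _, ENNReal.ofReal (B ^ p) ∂L := lintegral_mono fun ξ => by
      rw [enorm_rpow_eq_ofReal _ hp0.le]
      exact ENNReal.ofReal_le_ofReal (Real.rpow_le_rpow (abs_nonneg _) (hB ξ) hp0.le)
    refine (this.trans_lt ?_).ne
    simp
  set R := ‖∫ ξ, f ξ ∂L‖ₑ + M with hR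
  have hRfin : R ≠ ∞ := ENNReal.add_ne_top.2 ⟨enorm_ne_top, hM⟩
  have h1 := h.lintegral_enorm_le_of_isControl hf hB hG hfG
  set x := X.toReal ^ (1 / p) with hx
  have hx0 : 0 ≤ x := by positivity
  have hxX : ENNReal.ofReal x = X ^ (1 / p) := by
    rw [hx, ← ENNReal.ofReal_rpow_of_nonneg ENNReal.toReal_nonneg (by positivity),
      ENNReal.ofReal_toReal hXfin]
  have hxp : X = ENNReal.ofReal (x ^ p) := by
    rw [← ENNReal.ofReal_rpow_of_nonneg hx0 hp0.le, hxX, ← ENNReal.rpow_mul,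
      one_div_mul_cancel hp0.ne', ENNReal.rpow_one]
  have hxp2 : X ^ ((p - 2) / p) = ENNReal.ofReal (x ^ (p - 2)) := by
    rw [← ENNReal.ofReal_rpow_of_nonneg hx0 (by linarith), hxX, ← ENNReal.rpow_mul]
    congr 1; ring
  have key : x ≤ (64 + 4 * chainConst p) * R.toReal := by
    refine le_mul_of_forall_rpow_le hp hc hx0 ENNReal.toReal_nonneg fun r hr hRr => ?_
    have hRr' : R ≤ ENNReal.ofReal r := (ENNReal.le_ofReal_iff_toReal_le hRfin hr.le).2 hRr
    have hMr : M ≤ ENNReal.ofReal r := le_add_self.trans hRr'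
    -- The level is `K = 16 r`: as `E|f| ≤ R ≤ r`, the factor `4 E|f| / K` is at most `1 / 4`.
    have hK0 : ENNReal.ofReal (16 * r) ≠ 0 := by simpa using hr
    have hle := h.lintegral_enorm_rpow_le_of_isControl hp hf hB hGm hG hfG hK0
      ENNReal.ofReal_ne_top
    have hdiv : (∫⁻ ξ, ‖f ξ‖ₑ ∂L) / ENNReal.ofReal (16 * r) ≤ ENNReal.ofReal (1 / 16) := by
      refine (ENNReal.div_le_div_right (h1.trans hRr') _).trans ?_
      rw [← ENNReal.ofReal_div_of_pos (by positivity)]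
      refine ENNReal.ofReal_le_ofReal (le_of_eq ?_)
      field_simp
    have hle2 : X ≤ 4 * ENNReal.ofReal (16 * r) ^ p + 4 * (ENNReal.ofReal (1 / 16) * X) +
        2 * (ENNReal.ofReal (chainConst p) *
          (X ^ ((p - 2) / p) * ENNReal.ofReal r ^ 2 + ENNReal.ofReal r ^ p)) := by
      refine hle.trans ?_
      gcongr
    rw [hxp2, hxp, ENNReal.ofReal_rpow_of_nonneg (by positivity) hp0.le,
      ENNReal.ofReal_rpow_of_nonneg hr.le hp0.le, ← ENNReal.ofReal_pow hr.le,
      ← ENNReal.ofReal_mul (by positivity), ← ENNReal.ofReal_mul (by positivity),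
      ← ENNReal.ofReal_add (by positivity) (by positivity), ← ENNReal.ofReal_mul hc,
      ← ENNReal.ofReal_ofNat, ← ENNReal.ofReal_ofNat, ← ENNReal.ofReal_mul (by norm_num),
      ← ENNReal.ofReal_mul (by norm_num), ← ENNReal.ofReal_mul (by norm_num),
      ← ENNReal.ofReal_add (by positivity) (by positivity),
      ← ENNReal.ofReal_add (by positivity) (by positivity),
      ENNReal.ofReal_le_ofReal_iff (by positivity)] at hle2
    linarith
  calc X ^ (1 / p) = ENNReal.ofReal x := hxX.symm
    _ ≤ ENNReal.ofReal ((64 + 4 * chainConst p) * R.toReal) := ENNReal.ofReal_le_ofReal key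
    _ = poincareConst p * R := by
      rw [ENNReal.ofReal_mul (by linarith), ENNReal.ofReal_toReal hRfin]
      congr 1
      exact ENNReal.ofReal_coe_nnreal (p := poincareConst p)

end IsPoissonProcess

/-! ### General functionals and the two mixed norms -/

/-- Stated for any `ENorm` target, since the outer norm of `mixedNorm` acts on `ℝ≥0∞`-valued
functions. -/
theorem eLpNorm_ofReal_rpow {X ε : Type*} [MeasurableSpace X] [ENorm ε] (ν : Measure X)
    (f : X → ε) {s : ℝ} (hs : 0 < s) :
    eLpNorm f (ENNReal.ofReal s) ν ^ s = ∫⁻ x, ‖f x‖ₑ ^ s ∂ν := by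
  rw [eLpNorm_eq_lintegral_rpow_enorm_toReal (by simpa using hs) ENNReal.ofReal_ne_top,
    ENNReal.toReal_ofReal hs.le, ← ENNReal.rpow_mul, one_div_mul_cancel hs.ne', ENNReal.rpow_one]

theorem eLpNorm_ofReal_two_pow {X ε : Type*} [MeasurableSpace X] [ENorm ε] (ν : Measure X)
    (f : X → ε) : eLpNorm f (ENNReal.ofReal 2) ν ^ 2 = ∫⁻ x, ‖f x‖ₑ ^ 2 ∂ν := by
  have h := eLpNorm_ofReal_rpow ν f (s := 2) (by norm_num)
  exact_mod_cast h

theorem measurable_eLpNorm_ofReal {X Y : Type*} [MeasurableSpace X] [MeasurableSpace Y]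
    (ν : Measure Y) [SFinite ν] {G : X → Y → ℝ} (hG : Measurable (Function.uncurry G)) {s : ℝ}
    (hs : 0 < s) : Measurable fun x => eLpNorm (G x) (ENNReal.ofReal s) ν := by
  simp_rw [eLpNorm_eq_lintegral_rpow_enorm_toReal (p := ENNReal.ofReal s) (by simpa using hs)
    ENNReal.ofReal_ne_top]
  exact (Measurable.lintegral_prod_right' (f := fun z => ‖Function.uncurry G z‖ₑ ^ _)
    (hG.enorm.pow_const _)).pow_const _

section Control

variable {X U : Type*} [MeasurableSpace X] [MeasurableSpace U] {p : ℝ} {L : Measure X}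
  {μ : Measure U} [SFinite μ] {G : X → U → ℝ}

/-- Hölder in `ξ`, applied to the weight and the inner `L^2` norm in `u`. -/
theorem isControl_interNorm (hp : 2 ≤ p) (hG : Measurable (Function.uncurry G)) :
    IsControl p L μ G (interNorm p L μ G) where
  weighted w hw := by
    have hp0 : 0 < p := by linarith
    set N : X → ℝ≥0∞ := fun ξ => eLpNorm (G ξ) (ENNReal.ofReal 2) μ with hN
    have hNp : (∫⁻ ξ, N ξ ^ p ∂L) ^ (2 / p) = mixedNorm p 2 L μ G ^ 2 := by
      have := eLpNorm_ofReal_rpow L N hp0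
      simp only [enorm_eq_self] at this
      rw [← this, ← ENNReal.rpow_mul, mul_div_cancel₀ _ hp0.ne', mixedNorm,
        ENNReal.rpow_two]
    simp_rw [← eLpNorm_ofReal_two_pow]
    refine (lintegral_rpow_sub_two_mul_sq_le L hp hw.aemeasurable
      (measurable_eLpNorm_ofReal μ hG (by norm_num)).aemeasurable).trans ?_
    rw [hNp]
    gcongr
    exact le_max_left _ _
  power := by
    have hp0 : 0 < p := by linarith
    have h : mixedNorm p p L μ G ^ p = ∫⁻ ξ, ∫⁻ u, ‖G ξ u‖ₑ ^ p ∂μ ∂L := by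
      rw [mixedNorm, eLpNorm_ofReal_rpow _ _ hp0]
      exact lintegral_congr fun ξ => eLpNorm_ofReal_rpow μ (G ξ) hp0
    rw [← h]
    exact ENNReal.rpow_le_rpow (le_max_right _ _) hp0.le

/-- Tonelli comes first, and then Hölder in `ξ` for each fixed `u`. -/
theorem isControl_sigmaNorm [SFinite L] (hp : 2 ≤ p) (hG : Measurable (Function.uncurry G)) :
    IsControl p L μ G (sigmaNorm {2, p} p L μ G) where
  weighted w hw := by
    have hp0 : 0 < p := by linarith
    have hle : mixedNorm 2 p μ L (fun u ξ => G ξ u) ≤ sigmaNorm {2, p} p L μ G :=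
      Finset.single_le_sum (f := fun q => mixedNorm q p μ L fun u ξ => G ξ u)
        (fun _ _ => zero_le) (by simp)
    have hGu : ∀ u, Measurable fun ξ => G ξ u := fun u => hG.comp measurable_prodMk_right
    calc ∫⁻ ξ, w ξ ^ (p - 2) * ∫⁻ u, ‖G ξ u‖ₑ ^ 2 ∂μ ∂L
        = ∫⁻ ξ, ∫⁻ u, w ξ ^ (p - 2) * ‖G ξ u‖ₑ ^ 2 ∂μ ∂L := by
          refine lintegral_congr fun ξ => ?_
          rw [lintegral_const_mul]
          exact (hG.comp measurable_prodMk_left).enorm.pow_const 2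
      _ = ∫⁻ u, ∫⁻ ξ, w ξ ^ (p - 2) * ‖G ξ u‖ₑ ^ 2 ∂L ∂μ := by
          refine lintegral_lintegral_swap (Measurable.aemeasurable ?_)
          exact ((hw.comp measurable_fst).pow_const _).mul (hG.enorm.pow_const 2)
      _ ≤ ∫⁻ u, (∫⁻ ξ, w ξ ^ p ∂L) ^ ((p - 2) / p) *
            eLpNorm (fun ξ => G ξ u) (ENNReal.ofReal p) L ^ 2 ∂μ := by
          refine lintegral_mono fun u => ?_
          refine (lintegral_rpow_sub_two_mul_sq_le L hp hw.aemeasurable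
            (hGu u).enorm.aemeasurable).trans (le_of_eq ?_)
          rw [← eLpNorm_ofReal_rpow L (fun ξ => G ξ u) hp0, ← ENNReal.rpow_mul,
            mul_div_cancel₀ _ hp0.ne']
          norm_cast
      _ = (∫⁻ ξ, w ξ ^ p ∂L) ^ ((p - 2) / p) * mixedNorm 2 p μ L (fun u ξ => G ξ u) ^ 2 := by
          rw [lintegral_const_mul, mixedNorm, eLpNorm_ofReal_two_pow]
          · simp only [enorm_eq_self]
          · exact (measurable_eLpNorm_ofReal (G := fun u ξ => G ξ u) L
              (hG.comp measurable_swap) hp0).pow_const 2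
      _ ≤ _ := by gcongr
  power := by
    have hp0 : 0 < p := by linarith
    have hle : mixedNorm p p μ L (fun u ξ => G ξ u) ≤ sigmaNorm {2, p} p L μ G :=
      Finset.single_le_sum (f := fun q => mixedNorm q p μ L fun u ξ => G ξ u)
        (fun _ _ => zero_le) (by simp)
    have h : mixedNorm p p μ L (fun u ξ => G ξ u) ^ p = ∫⁻ ξ, ∫⁻ u, ‖G ξ u‖ₑ ^ p ∂μ ∂L := by
      rw [mixedNorm, eLpNorm_ofReal_rpow _ _ hp0,
        lintegral_lintegral_swap (hG.enorm.pow_const p).aemeasurable]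
      exact lintegral_congr fun u => eLpNorm_ofReal_rpow L (fun ξ => G ξ u) hp0
    rw [← h]
    exact ENNReal.rpow_le_rpow hle hp0.le

end Control

/-! ### Truncation, and transfer between the process and its law -/

/-- Truncation is a contraction, so the difference operator of a truncated functional is dominated
by the original one, uniformly in the level. -/
theorem abs_clamp_sub_clamp_le (n a b : ℝ) :
    |max (-n) (min a n) - max (-n) (min b n)| ≤ |a - b| := by
  refine (abs_max_sub_max_le_max _ _ _ _).trans ?_
  refine max_le (by simp) ((abs_min_sub_min_le_max _ _ _ _).trans ?_)
  simp

theorem abs_clamp_le {n : ℝ} (hn : 0 ≤ n) (a : ℝ) : |max (-n) (min a n)| ≤ n :=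
  abs_le.2 ⟨le_max_left _ _, max_le (by linarith) (min_le_right _ _)⟩

theorem abs_clamp_le_abs {n : ℝ} (hn : 0 ≤ n) (a : ℝ) : |max (-n) (min a n)| ≤ |a| := by
  simpa [hn] using abs_clamp_sub_clamp_le n a 0

theorem tendsto_clamp (a : ℝ) :
    Filter.Tendsto (fun n : ℕ => max (-(n : ℝ)) (min a n)) Filter.atTop (nhds a) := by
  refine tendsto_const_nhds.congr' ?_
  filter_upwards [Filter.eventually_ge_atTop ⌈|a|⌉₊] with n hn
  have h := abs_le.1 (Nat.ceil_le.1 hn)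
  rw [min_eq_left h.2, max_eq_right h.1]

namespace IsPoissonProcess

variable {U : Type*} [MeasurableSpace U] {μ : Measure U}

/-- The `L^p` Poincaré inequality for the law of a Poisson process. -/
theorem eLpNorm_le_of_isControl [SigmaFinite μ] {L : Measure (CountingMeasure U)} [IsProbabilityMeasure L]
    (h : IsPoissonProcess id μ L) {p : ℝ} (hp : 2 ≤ p) {f : CountingMeasure U → ℝ}
    (hf : Measurable f) (hfi : Integrable f L) {M : ℝ≥0∞}
    (hM : IsControl p L μ (fun ξ u => diffOp u f ξ) M) :
    eLpNorm f (ENNReal.ofReal p) L ≤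
      poincareConst p * (ENNReal.ofReal |∫ ξ, f ξ ∂L| + M) := by
  have hp0 : 0 < p := by linarith
  set F : ℕ → CountingMeasure U → ℝ := fun n ξ => max (-(n : ℝ)) (min (f ξ) n) with hF
  have mF : ∀ n, Measurable (F n) := fun n => measurable_const.max (hf.min measurable_const)
  have hlim : Filter.Tendsto (fun n => ∫ ξ, F n ξ ∂L) Filter.atTop (nhds (∫ ξ, f ξ ∂L)) :=
    tendsto_integral_of_dominated_convergence (fun ξ => |f ξ|)
      (fun n => (mF n).aestronglyMeasurable) hfi.abs
      (fun n => Filter.Eventually.of_forall fun ξ => abs_clamp_le_abs n.cast_nonneg _)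
      (Filter.Eventually.of_forall fun ξ => tendsto_clamp _)
  have hbd : ∀ n, eLpNorm (F n) (ENNReal.ofReal p) L ≤
      poincareConst p * (ENNReal.ofReal |∫ ξ, F n ξ ∂L| + M) := fun n => by
    rw [eLpNorm_eq_lintegral_rpow_enorm_toReal (by simpa using hp0) ENNReal.ofReal_ne_top,
      ENNReal.toReal_ofReal hp0.le, ← Real.enorm_eq_ofReal_abs]
    exact h.lintegral_rpow_le_of_bounded hp (mF n) (fun ξ => abs_clamp_le n.cast_nonneg _)
      (G := fun ξ u => diffOp u f ξ) (measurable_diffOp hf) hM fun ξ u => abs_clamp_sub_clamp_le _ _ _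
  -- Fatou on the left; on the right only the means vary with `n`, and they converge by dominated
  -- convergence.
  refine (Lp.eLpNorm_lim_le_liminf_eLpNorm (fun n => (mF n).aestronglyMeasurable) f
    (Filter.Eventually.of_forall fun ξ => tendsto_clamp _)).trans ?_
  have hlim2 : Filter.Tendsto (fun n => poincareConst p * (ENNReal.ofReal |∫ ξ, F n ξ ∂L| + M))
      Filter.atTop (nhds (poincareConst p * (ENNReal.ofReal |∫ ξ, f ξ ∂L| + M))) :=
    ENNReal.Tendsto.const_mul ((ENNReal.tendsto_ofReal hlim.abs).add tendsto_const_nhds)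
      (Or.inr ENNReal.coe_ne_top)
  rw [← hlim2.liminf_eq]
  exact Filter.liminf_le_liminf (Filter.Eventually.of_forall hbd)

variable {Ω : Type*} [MeasurableSpace Ω] {P : Measure Ω} {η : Ω → CountingMeasure U}

theorem interNorm_map [SigmaFinite μ] (hη : Measurable η) {p : ℝ} (hp : 0 < p)
    {f : CountingMeasure U → ℝ} (hf : Measurable f) : interNorm p (P.map η) μ (fun ξ u => diffOp u f ξ) =
      interNorm p P μ (fun ω u => diffOp u f (η ω)) := by
  have e : ∀ q : ℝ, 0 < q → mixedNorm p q (P.map η) μ (fun ξ u => diffOp u f ξ) =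
      mixedNorm p q P μ (fun ω u => diffOp u f (η ω)) := fun q hq => by
    rw [mixedNorm, eLpNorm_map_measure ?_ hη.aemeasurable]
    · rfl
    · exact (measurable_eLpNorm_ofReal μ (G := fun ξ u => diffOp u f ξ) (measurable_diffOp hf)
        hq).aestronglyMeasurable
  rw [interNorm, interNorm, e 2 (by norm_num), e p hp]

theorem sigmaNorm_map (hη : Measurable η) (S : Finset ℝ) (p : ℝ) {f : CountingMeasure U → ℝ}
    (hf : Measurable f) : sigmaNorm S p (P.map η) μ (fun ξ u => diffOp u f ξ) =
      sigmaNorm S p P μ (fun ω u => diffOp u f (η ω)) := by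
  refine Finset.sum_congr rfl fun q _ => ?_
  simp only [mixedNorm]
  congr 1
  ext u
  rw [eLpNorm_map_measure ?_ hη.aemeasurable]
  · rfl
  · exact ((measurable_diffOp hf).comp measurable_prodMk_right).aestronglyMeasurable

end IsPoissonProcess

theorem proposition3p7 (p : ℝ) (hp : 2 ≤ p) :
    ∃ C : ℝ≥0, ∀ (Ω : Type*) [MeasurableSpace Ω] (P : Measure Ω) [IsProbabilityMeasure P]
      (U : Type*) [MeasurableSpace U] (μ : Measure U) [SigmaFinite μ]
      (η : Ω → CountingMeasure U), IsPoissonProcess η μ P →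
      ∀ f : CountingMeasure U → ℝ, Measurable f → Integrable (fun ω => f (η ω)) P →
        eLpNorm (fun ω => f (η ω)) (ENNReal.ofReal p) P ≤
            C * (ENNReal.ofReal |∫ ω, f (η ω) ∂P| +
              interNorm p P μ (fun ω u => diffOp u f (η ω))) ∧
        eLpNorm (fun ω => f (η ω)) (ENNReal.ofReal p) P ≤
            C * (ENNReal.ofReal |∫ ω, f (η ω) ∂P| +
              sigmaNorm {2, p} p P μ (fun ω u => diffOp u f (η ω))) := by
  refine ⟨poincareConst p, fun Ω _ P _ U _ μ _ η h f hf hfi => ?_⟩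
  have hη := h.measurable
  have := Measure.isProbabilityMeasure_map (μ := P) hη.aemeasurable
  have hL := h.isPoissonProcess_id_map
  have hfi' : Integrable f (P.map η) :=
    (integrable_map_measure hf.aestronglyMeasurable hη.aemeasurable).2 hfi
  have e1 : eLpNorm (fun ω => f (η ω)) (ENNReal.ofReal p) P =
      eLpNorm f (ENNReal.ofReal p) (P.map η) :=
    (eLpNorm_map_measure hf.aestronglyMeasurable hη.aemeasurable).symm
  have e2 : ∫ ω, f (η ω) ∂P = ∫ ξ, f ξ ∂P.map η :=
    (integral_map hη.aemeasurable hf.aestronglyMeasurable).symm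
  rw [e1, e2, ← IsPoissonProcess.interNorm_map hη (by linarith) hf,
    ← IsPoissonProcess.sigmaNorm_map hη _ _ hf]
  exact ⟨hL.eLpNorm_le_of_isControl hp hf hfi' (isControl_interNorm hp (measurable_diffOp hf)),
    hL.eLpNorm_le_of_isControl hp hf hfi' (isControl_sigmaNorm hp (measurable_diffOp hf))⟩
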